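/- Let $G$ be a (Hausdorff, second countable) Lie group and $N,H\le G$ closed subgroups with $N$ normal and abelian such that $G=N\ltimes H$, i.e. $N\times H\to G$, $(n,h)\mapsto nh$, is a diffeomorphism. Let $\nu:N\to\mathbb T$ be a (smooth) unitary character, let $G_\nu=\{x\in G:\nu(x^{-1}nx)=\nu(n)\ \forall n\in N\}$ be its isotropy group and $H_\nu=H\cap G_\nu$ the little group, and give $H/H_\nu$ its quotient manifold structure. Let $\sigma$ be a unitary representation of $H_\nu$ on a finite-dimensional Hilbert space $(\mathcal H_\sigma,\langle\cdot,\cdot\rangle_\sigma)$ that extends to a smooth representation $\Phi:H\to GL(\mathcal H_\sigma)$, let $L:H/H_\nu\to H$ be a smooth global section of $H\to H/H_\nu$, and let $\mu$ be an $H$-invariant Borel measure on $H/H_\nu$. Let $\nu\sigma:G_\nu\to U(\mathcal H_\sigma)$ be the representation $\nu\sigma(nh)=\nu(n)\sigma(h)$ ($n\in N$, $h\in H_\nu$), and put $W_L(x,yH_\nu)=L(xyH_\nu)^{-1}\,x\,L(yH_\nu)\in H_\nu$ for $x,y\in H$. Let $G$ act on $H/H_\nu$ by $l_{nh}(yH_\nu)=hyH_\nu$.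 On the product bundle $H/H_\nu\times\mathcal H_\sigma\to H/H_\nu$ consider two structures: * the perception bundle $E_\sigma$, with metric $h\big((xH_\nu,v),(xH_\nu,w)\big)=\langle v,\Phi(x)^{\dagger-1}\Phi(x)^{-1}w\rangle_\sigma$ and action $\lambda(nh)(yH_\nu,v)=\big(hyH_\nu,\ \nu((hy)^{-1}nhy)\,\Phi(h)v\big)$; * the boosting bundle $E_{L,\sigma}$, with metric $h_L\big((xH_\nu,v),(xH_\nu,w)\big)=\langle v,w\rangle_\sigma$ and action $\lambda_L(nh)(yH_\nu,v)=\big(hyH_\nu,\ \nu((hy)^{-1}nhy)\,\sigma(W_L(h,yH_\nu))v\big)$. Then: 1. Both are smooth Hermitian $G$-bundles over $H/H_\nu$: the metrics are well-defined smooth Hermitian metrics, and $\lambda,\lambda_L$ are smooth $G$-actions covering $l$ by isometric bundle isomorphisms. 2. The map $\alpha:E_\sigma\to E_{L,\sigma}$, $(xH_\nu,v)\mapsto\big(xH_\nu,\Phi(L(xH_\nu)^{-1})v\big)$, is a Hermitian $G$-bundle isomorphism: a diffeomorphism over $H/H_\nu$ that is fibrewise linear, isometric and $G$-equivariant. 3.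 Let $U(s)\phi=\lambda(s)\circ\phi\circ l_s^{-1}$ and $U_L(s)\psi=\lambda_L(s)\circ\psi\circ l_s^{-1}$ on the Hilbert spaces $L^2(H/H_\nu,E_\sigma;\mu,h)$ and $L^2(H/H_\nu,E_{L,\sigma};\mu,h_L)$ of square-integrable Borel sections modulo null sections. Let $\mathrm{Ind}_{G_\nu}^G\nu\sigma$ be the induced representation $[\mathrm{Ind}(x)f](y)=f(x^{-1}y)$ on the Hilbert space of Borel functions $f:G\to\mathcal H_\sigma$ with $f(gk)=\nu\sigma(k)^{-1}f(g)$ for $k\in G_\nu$ and $\int_{G/G_\nu}\|f\|_\sigma^2\,d\mu<\infty$, modulo null functions, where $\mu$ is transported by the bijection $H/H_\nu\to G/G_\nu$, $hH_\nu\mapsto hG_\nu$. These are unitary representations of $G$ on Hilbert spaces (strongly continuous when $\mu$ is a Radon measure), and $$\mathrm{Ind}_{G_\nu}^G\nu\sigma\;\cong\;U\;\cong\;U_L$$ (unitary equivalence); $\phi\mapsto\alpha\circ\phi$ is a unitary equivalence of $U$ with $U_L$. 4. $f\otimes v\mapsto f(\cdot)v$ induces a unitary isomorphism $L^2(H/H_\nu;\mu)\otimes\mathcal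 H_\sigma\cong L^2(H/H_\nu,E_{L,\sigma};\mu,h_L)$. -/

import Mathlib

open MeasureTheory Manifold
open scoped ContDiff ComplexConjugate TensorProduct

noncomputable section

/-! ### Unitary representations on the Hausdorff quotient of a pre-Hilbert space -/

section Generic

/-- The positive semidefinite sesquilinear form `⟨f, g⟩ = ∫ B(f, g) dμ` obtained by integrating a
pointwise positive semidefinite Hermitian form `B`. -/
@[reducible]
def integralCore {S M : Type*} [AddCommGroup S] [Module ℂ S] [MeasurableSpace M] (μ : Measure M)
    (B : S → S → M → ℂ) (hint : ∀ f g, Integrable (B f g) μ)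
    (hsymm : ∀ f g m, conj (B g f m) = B f g m) (hnn : ∀ f m, 0 ≤ (B f f m).re)
    (hadd : ∀ f g k m, B (f + g) k m = B f k m + B g k m)
    (hsmul : ∀ (c : ℂ) f g m, B (c • f) g m = conj c * B f g m) :
    PreInnerProductSpace.Core ℂ S where
  inner f g := ∫ m, B f g m ∂μ
  conj_inner_symm f g := by
    rw [← integral_conj]
    exact integral_congr_ae (Filter.Eventually.of_forall fun m => hsymm f g m)
  re_inner_nonneg f := by
    rw [← integral_re (hint f f)]
    exact integral_nonneg fun m => hnn f m
  add_left f g k := by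
    rw [← integral_add (hint f k) (hint g k)]
    exact integral_congr_ae (Filter.Eventually.of_forall fun m => hadd f g k m)
  smul_left f g c := by
    rw [← integral_const_mul]
    exact integral_congr_ae (Filter.Eventually.of_forall fun m => hsmul c f g m)

variable {G X Y : Type*} [Group G]

/-- A linear isometric action on a pre-Hilbert space `X` descends to a unitary representation on
the associated separated space, that is, on `X` modulo the vectors of norm zero. -/
def quotRep [SeminormedAddCommGroup X] [InnerProductSpace ℂ X] (T : G →* Module.End ℂ X)
    (hT : ∀ s f, ‖T s f‖ = ‖f‖) :
    G →* (SeparationQuotient X ≃ₗᵢ[ℂ] SeparationQuotient X) :=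
  let T' (s : G) : X →L[ℂ] X := (⟨T s, hT s⟩ : X →ₗᵢ[ℂ] X).toContinuousLinearMap
  let q (s : G) : SeparationQuotient X →ₗ[ℂ] SeparationQuotient X :=
    (SeparationQuotient.liftCLM ((SeparationQuotient.mkCLM ℂ X).comp (T' s)) fun a b hab => by
      have : Inseparable (T' s a) (T' s b) := hab.map (T' s).continuous
      exact SeparationQuotient.mk_eq_mk.2 this).toLinearMap
  have hq (s : G) (f : X) : q s (SeparationQuotient.mk f) = SeparationQuotient.mk (T s f) := rfl
  have hmul (s t : G) (f : SeparationQuotient X) : q (s * t) f = q s (q t f) := by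
    obtain ⟨f, rfl⟩ := SeparationQuotient.surjective_mk f
    simp [hq]
  have hone (f : SeparationQuotient X) : q 1 f = f := by
    obtain ⟨f, rfl⟩ := SeparationQuotient.surjective_mk f
    simp [hq]
  { toFun := fun s =>
      { toLinearEquiv := LinearEquiv.ofLinearMap (q s) (q s⁻¹)
          (LinearMap.ext fun f => by
            simp only [LinearMap.comp_apply, ← hmul, mul_inv_cancel, hone, LinearMap.id_apply])
          (LinearMap.ext fun f => by
            simp only [LinearMap.comp_apply, ← hmul, inv_mul_cancel, hone, LinearMap.id_apply])
        norm_map' := fun f => by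
          obtain ⟨f, rfl⟩ := SeparationQuotient.surjective_mk f
          change ‖q s (SeparationQuotient.mk f)‖ = _
          rw [hq, SeparationQuotient.norm_mk, SeparationQuotient.norm_mk, hT] }
    map_one' := LinearIsometryEquiv.ext fun f => hone f
    map_mul' := fun s t => LinearIsometryEquiv.ext fun f => hmul s t f }

/-- Unitary equivalence of unitary representations. -/
def UnitarilyEquivalent [NormedAddCommGroup X] [InnerProductSpace ℂ X]
    [NormedAddCommGroup Y] [InnerProductSpace ℂ Y]
    (π₁ : G →* (X ≃ₗᵢ[ℂ] X)) (π₂ : G →* (Y ≃ₗᵢ[ℂ] Y)) : Prop :=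
  ∃ T : X ≃ₗᵢ[ℂ] Y, ∀ s f, T (π₁ s f) = π₂ s (T f)

/-- Strong continuity of a unitary representation. -/
def StronglyContinuous [TopologicalSpace G] [NormedAddCommGroup X] [InnerProductSpace ℂ X]
    (π : G →* (X ≃ₗᵢ[ℂ] X)) : Prop :=
  ∀ f, Continuous fun s => π s f

end Generic

/-! ### Hermitian `G`-bundles with underlying vector bundle `M × V → M` -/

/-- A Hermitian `G`-bundle over the `G`-space `(M, l)` whose underlying vector bundle is the product
bundle `M × V → M`: a fibrewise Hermitian metric (conjugate-linear in the first variable) and an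
action of `G` on the total space covering `l` by isometric bundle isomorphisms. Smoothness is the
separate predicate `HermitianGBundle.IsSmooth`. -/
structure HermitianGBundle {G M : Type*} [Group G] [TopologicalSpace M] (l : G →* Equiv.Perm M)
    (V : Type*) [NormedAddCommGroup V] [InnerProductSpace ℂ V] where
  /-- the metric on the fibre `{x} × V` -/
  metric : M → V →ₗ⋆[ℂ] V →ₗ[ℂ] ℂ
  metric_symm : ∀ x v w, conj (metric x w v) = metric x v w
  metric_pos : ∀ x v, v ≠ 0 → 0 < (metric x v v).re
  continuous_metric : Continuous fun p : M × V × V => metric p.1 p.2.1 p.2.2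
  /-- the action on the total space -/
  act : G →* Equiv.Perm (M × V)
  act_fst : ∀ s p, (act s p).1 = l s p.1
  act_add : ∀ s x v w, (act s (x, v + w)).2 = (act s (x, v)).2 + (act s (x, w)).2
  act_smul : ∀ s x (c : ℂ) v, (act s (x, c • v)).2 = c • (act s (x, v)).2
  act_isometry : ∀ s x v w,
    metric (l s x) (act s (x, v)).2 (act s (x, w)).2 = metric x v w
  continuous_act : ∀ s, Continuous (act s)

namespace HermitianGBundle

variable {G M V : Type*} [Group G] [TopologicalSpace M]
  [NormedAddCommGroup V] [InnerProductSpace ℂ V] {l : G →* Equiv.Perm M}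

/-- The Hermitian `G`-bundle is smooth: the actions on the base and on the total space are smooth
actions of the Lie group `G`, and the metric is smooth. -/
structure IsSmooth (B : HermitianGBundle l V)
    {EG EM : Type*} [NormedAddCommGroup EG] [NormedSpace ℝ EG] [NormedAddCommGroup EM]
    [NormedSpace ℝ EM] [TopologicalSpace G] [ChartedSpace EG G] [ChartedSpace EM M] : Prop where
  base : ContMDiff (𝓘(ℝ, EG).prod 𝓘(ℝ, EM)) 𝓘(ℝ, EM) ∞ fun p : G × M => l p.1 p.2
  metric : ContMDiff (𝓘(ℝ, EM).prod (𝓘(ℝ, V).prod 𝓘(ℝ, V))) 𝓘(ℝ, ℂ) ∞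
    fun p : M × V × V => B.metric p.1 p.2.1 p.2.2
  act : ContMDiff (𝓘(ℝ, EG).prod (𝓘(ℝ, EM).prod 𝓘(ℝ, V))) (𝓘(ℝ, EM).prod 𝓘(ℝ, V)) ∞
    fun p : G × (M × V) => B.act p.1 p.2

/-- `α` is an isomorphism of Hermitian `G`-bundles over `M`: a diffeomorphism of the total spaces
over the identity of `M` that is fibrewise linear, isometric and `G`-equivariant. -/
structure IsIso (B B' : HermitianGBundle l V) (α : M × V → M × V)
    {EM : Type*} [NormedAddCommGroup EM] [NormedSpace ℝ EM] [ChartedSpace EM M] : Prop where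
  diffeo : ∃ e : Diffeomorph (𝓘(ℝ, EM).prod 𝓘(ℝ, V)) (𝓘(ℝ, EM).prod 𝓘(ℝ, V)) (M × V) (M × V) ∞,
    ⇑e = α
  fst : ∀ p, (α p).1 = p.1
  map_add : ∀ x v w, (α (x, v + w)).2 = (α (x, v)).2 + (α (x, w)).2
  map_smul : ∀ x (c : ℂ) v, (α (x, c • v)).2 = c • (α (x, v)).2
  isometry : ∀ x v w, B'.metric x (α (x, v)).2 (α (x, w)).2 = B.metric x v w
  equivariant : ∀ s p, α (B.act s p) = B'.act s (α p)

section L2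

theorem metric_nonneg (B : HermitianGBundle l V) (x : M) (v : V) : 0 ≤ (B.metric x v v).re := by
  by_cases hv : v = 0
  · simp [hv]
  · exact (B.metric_pos x v hv).le

theorem norm_metric_le (B : HermitianGBundle l V) (x : M) (v w : V) :
    ‖B.metric x v w‖ ≤ (B.metric x v v).re + (B.metric x w w).re := by
  let c : PreInnerProductSpace.Core ℂ V :=
    { inner := fun v w => B.metric x v w
      conj_inner_symm := fun v w => B.metric_symm x v w
      re_inner_nonneg := fun v => B.metric_nonneg x v
      add_left := fun u v w => by simp
      smul_left := fun u v r => by simp }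
  have h : ‖B.metric x v w‖ * ‖B.metric x w v‖ ≤ (B.metric x v v).re * (B.metric x w w).re :=
    InnerProductSpace.Core.inner_mul_inner_self_le (c := c) v w
  have h2 : ‖B.metric x w v‖ = ‖B.metric x v w‖ := by
    rw [← B.metric_symm x v w, RCLike.norm_conj]
  rw [h2] at h
  have h3 := B.metric_nonneg x v
  have h4 := B.metric_nonneg x w
  have h5 := norm_nonneg (B.metric x v w)
  nlinarith

theorem metric_add_self_le (B : HermitianGBundle l V) (x : M) (v w : V) :
    (B.metric x (v + w) (v + w)).re ≤ 2 * (B.metric x v v).re + 2 * (B.metric x w w).re := by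
  have h := B.metric_nonneg x (v - w)
  simp only [map_add, map_sub, LinearMap.add_apply, LinearMap.sub_apply, Complex.add_re,
    Complex.sub_re] at h ⊢
  linarith

variable [MeasurableSpace M] [OpensMeasurableSpace M] [FiniteDimensional ℂ V]
  [MeasurableSpace V] [BorelSpace V]

theorem measurable_metric (B : HermitianGBundle l V) {f g : M → V} (hf : Measurable f)
    (hg : Measurable g) : Measurable fun x => B.metric x (f x) (g x) := by
  have : ProperSpace V := FiniteDimensional.proper ℂ V
  have : SecondCountableTopology V := secondCountable_of_proper
  exact B.continuous_metric.measurable.comp (measurable_id.prodMk (hf.prodMk hg))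

/-- Borel sections `ψ(x) = (x, f x)` of `M × V` with `∫ h(ψ, ψ) dμ < ∞`. -/
def l2Submodule (B : HermitianGBundle l V) (μ : Measure M) : Submodule ℂ (M → V) where
  carrier := {f | Measurable f ∧ ∫⁻ x, ENNReal.ofReal (B.metric x (f x) (f x)).re ∂μ < ⊤}
  zero_mem' := ⟨measurable_const, by simp⟩
  add_mem' := by
    have : ProperSpace V := FiniteDimensional.proper ℂ V
    have : SecondCountableTopology V := secondCountable_of_proper
    rintro f g ⟨hf, hf'⟩ ⟨hg, hg'⟩
    refine ⟨hf.add hg, ?_⟩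
    have hm : Measurable fun x => ENNReal.ofReal (B.metric x (f x) (f x)).re :=
      (Complex.measurable_re.comp (B.measurable_metric hf hf)).ennreal_ofReal
    calc ∫⁻ x, ENNReal.ofReal (B.metric x ((f + g) x) ((f + g) x)).re ∂μ
        ≤ ∫⁻ x, (2 * ENNReal.ofReal (B.metric x (f x) (f x)).re
            + 2 * ENNReal.ofReal (B.metric x (g x) (g x)).re) ∂μ := by
          refine lintegral_mono fun x => ?_
          have h2 : (2 : ENNReal) = ENNReal.ofReal 2 := by simp
          rw [h2, ← ENNReal.ofReal_mul (by norm_num), ← ENNReal.ofReal_mul (by norm_num),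
            ← ENNReal.ofReal_add (by have := B.metric_nonneg x (f x); positivity)
              (by have := B.metric_nonneg x (g x); positivity)]
          exact ENNReal.ofReal_le_ofReal (B.metric_add_self_le x (f x) (g x))
      _ = 2 * ∫⁻ x, ENNReal.ofReal (B.metric x (f x) (f x)).re ∂μ
            + 2 * ∫⁻ x, ENNReal.ofReal (B.metric x (g x) (g x)).re ∂μ := by
          rw [lintegral_add_left (hm.const_mul 2), lintegral_const_mul' _ _ (by simp),
            lintegral_const_mul' _ _ (by simp)]
      _ < ⊤ := by
          refine ENNReal.add_lt_top.2 ⟨ENNReal.mul_lt_top (by simp) hf',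
            ENNReal.mul_lt_top (by simp) hg'⟩
  smul_mem' := by
    rintro c f ⟨hf, hf'⟩
    refine ⟨hf.const_smul c, ?_⟩
    have : ∀ x, ENNReal.ofReal (B.metric x ((c • f) x) ((c • f) x)).re
        = ENNReal.ofReal (‖c‖ ^ 2) * ENNReal.ofReal (B.metric x (f x) (f x)).re := by
      intro x
      rw [← ENNReal.ofReal_mul (by positivity)]
      congr 1
      have : B.metric x ((c • f) x) ((c • f) x) = ((‖c‖ ^ 2 : ℝ) : ℂ) * B.metric x (f x) (f x) := by
        simp only [Pi.smul_apply, map_smulₛₗ, LinearMap.smul_apply, smul_eq_mul, RingHom.id_apply]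
        rw [← mul_assoc, ← Complex.normSq_eq_norm_sq, ← Complex.mul_conj]
      rw [this, Complex.re_ofReal_mul]
    simp_rw [this]
    rw [lintegral_const_mul' _ _ (by simp)]
    exact ENNReal.mul_lt_top (by simp) hf'

/-- The space of square-integrable Borel sections, before identifying almost everywhere equal
sections; it is a pre-Hilbert space for `⟨ψ, φ⟩ = ∫ h(ψ, φ) dμ`. -/
def L2Pre (B : HermitianGBundle l V) (μ : Measure M) : Type _ := B.l2Submodule μ

variable (B : HermitianGBundle l V) (μ : Measure M)

instance : AddCommGroup (B.L2Pre μ) := inferInstanceAs (AddCommGroup (B.l2Submodule μ))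

instance : Module ℂ (B.L2Pre μ) := inferInstanceAs (Module ℂ (B.l2Submodule μ))

/-- The underlying function `f` of the section `x ↦ (x, f x)`. -/
def L2Pre.fn {B : HermitianGBundle l V} {μ : Measure M} (f : B.L2Pre μ) : M → V :=
  (B.l2Submodule μ).subtype f

instance : CoeFun (B.L2Pre μ) (fun _ => M → V) := ⟨L2Pre.fn⟩

/-- A square-integrable Borel section as an element of `L2Pre`. -/
def L2Pre.mk {B : HermitianGBundle l V} {μ : Measure M} (f : M → V) (hf : Measurable f)
    (hf' : ∫⁻ x, ENNReal.ofReal (B.metric x (f x) (f x)).re ∂μ < ⊤) : B.L2Pre μ :=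
  (⟨f, hf, hf'⟩ : B.l2Submodule μ)

variable {B μ} in
theorem L2Pre.ext {f g : B.L2Pre μ} (h : ∀ x, f x = g x) : f = g := Subtype.ext (funext h)

variable {B μ} in
theorem L2Pre.measurable (f : B.L2Pre μ) : Measurable f := Subtype.property f |>.1

variable {B μ} in
theorem L2Pre.lintegral_lt_top (f : B.L2Pre μ) :
    ∫⁻ x, ENNReal.ofReal (B.metric x (f x) (f x)).re ∂μ < ⊤ := Subtype.property f |>.2

theorem integrable_metric (f g : B.L2Pre μ) :
    Integrable (fun x => B.metric x (f x) (g x)) μ := by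
  have key : ∀ f : B.L2Pre μ, Integrable (fun x => (B.metric x (f x) (f x)).re) μ := fun f =>
    ⟨(Complex.measurable_re.comp (B.measurable_metric f.measurable f.measurable)).aestronglyMeasurable,
      (hasFiniteIntegral_iff_ofReal
        (Filter.Eventually.of_forall fun x => B.metric_nonneg x (f x))).2 f.lintegral_lt_top⟩
  exact ((key f).add (key g)).mono' (B.measurable_metric f.measurable g.measurable).aestronglyMeasurable
    (Filter.Eventually.of_forall fun x => B.norm_metric_le x (f x) (g x))

/-- The inner product `∫ h(ψ, φ) dμ`. -/
@[reducible]
def l2Core : PreInnerProductSpace.Core ℂ (B.L2Pre μ) :=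
  integralCore μ (fun f g x => B.metric x (f x) (g x)) (B.integrable_metric μ)
    (fun f g x => B.metric_symm x (f x) (g x)) (fun f x => B.metric_nonneg x (f x))
    (fun f g k x => by
      change B.metric x (f x + g x) (k x) = _
      simp)
    (fun c f g x => by
      change B.metric x (c • f x) (g x) = _
      simp)

instance : SeminormedAddCommGroup (B.L2Pre μ) :=
  @InnerProductSpace.Core.toSeminormedAddCommGroup ℂ _ _ _ _ (B.l2Core μ)

instance : InnerProductSpace ℂ (B.L2Pre μ) := InnerProductSpace.ofCore (B.l2Core μ)

/-- The `L²`-section space: square-integrable Borel sections modulo sections of norm zero, that is,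
modulo equality almost everywhere. -/
abbrev L2Section : Type _ := SeparationQuotient (B.L2Pre μ)

/-- The class of a square-integrable Borel section. -/
abbrev toL2 (f : B.L2Pre μ) : B.L2Section μ := SeparationQuotient.mk f

variable {μ}

/-- `f ↦ λ(s) ∘ f ∘ l_s⁻¹` on square-integrable Borel sections. -/
def preRepFun (hμ : ∀ s, MeasurePreserving (l s) μ μ) (s : G) (f : B.L2Pre μ) : B.L2Pre μ :=
  have hm : Measurable fun x => (B.act s ((l s)⁻¹ x, f ((l s)⁻¹ x))).2 := by
    have : ProperSpace V := FiniteDimensional.proper ℂ V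
    have : SecondCountableTopology V := secondCountable_of_proper
    have hl : Measurable ⇑(l s)⁻¹ := by
      have := (hμ s⁻¹).measurable
      rwa [map_inv] at this
    exact ((continuous_snd.comp (B.continuous_act s)).measurable).comp
      (hl.prodMk (f.measurable.comp hl))
  L2Pre.mk (fun x => (B.act s ((l s)⁻¹ x, f ((l s)⁻¹ x))).2) hm (by
    have h2 := f.lintegral_lt_top
    have h3 := (hμ s).lintegral_comp (f := fun x => ENNReal.ofReal
        (B.metric x (B.act s ((l s)⁻¹ x, f ((l s)⁻¹ x))).2
          (B.act s ((l s)⁻¹ x, f ((l s)⁻¹ x))).2).re)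
      (Complex.measurable_re.comp (B.measurable_metric hm hm)).ennreal_ofReal
    have h4 : ∀ x, (l s)⁻¹ (l s x) = x := (l s).symm_apply_apply
    simp only [B.act_isometry, h4] at h3
    rwa [← h3])

/-- The action `f ↦ λ(s) ∘ f ∘ l_s⁻¹` of `G` on square-integrable Borel sections. -/
def preRep (hμ : ∀ s, MeasurePreserving (l s) μ μ) : G →* Module.End ℂ (B.L2Pre μ) where
  toFun s :=
    { toFun := B.preRepFun hμ s
      map_add' := fun _ _ => L2Pre.ext fun _ => B.act_add s _ _ _
      map_smul' := fun c _ => L2Pre.ext fun _ => B.act_smul s _ c _ }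
  map_one' := LinearMap.ext fun f => L2Pre.ext fun x => by
    change (B.act 1 ((l 1)⁻¹ x, f ((l 1)⁻¹ x))).2 = f x
    simp
  map_mul' s t := LinearMap.ext fun f => L2Pre.ext fun x => by
    change (B.act (s * t) ((l (s * t))⁻¹ x, f ((l (s * t))⁻¹ x))).2
      = (B.act s ((l s)⁻¹ x, (B.act t ((l t)⁻¹ ((l s)⁻¹ x), f ((l t)⁻¹ ((l s)⁻¹ x)))).2)).2
    rw [map_mul, Equiv.Perm.mul_apply, map_mul, mul_inv_rev, Equiv.Perm.mul_apply]
    congr 2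
    refine Prod.ext ?_ rfl
    rw [B.act_fst]
    simp

theorem preRep_apply (hμ : ∀ s, MeasurePreserving (l s) μ μ) (s : G) (f : B.L2Pre μ) (x : M) :
    (x, B.preRep hμ s f x) = B.act s ((l s)⁻¹ x, f ((l s)⁻¹ x)) := by
  refine Prod.ext ?_ rfl
  rw [B.act_fst]
  simp

theorem norm_preRep (hμ : ∀ s, MeasurePreserving (l s) μ μ) (s : G) (f : B.L2Pre μ) :
    ‖B.preRep hμ s f‖ = ‖f‖ := by
  have hm := B.measurable_metric (B.preRep hμ s f).measurable (B.preRep hμ s f).measurable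
  change √(RCLike.re (∫ x, B.metric x (B.preRep hμ s f x) (B.preRep hμ s f x) ∂μ))
    = √(RCLike.re (∫ x, B.metric x (f x) (f x) ∂μ))
  congr 2
  have h : ∀ x, B.metric x (f x) (f x)
      = B.metric (l s x) (B.preRep hμ s f (l s x)) (B.preRep hμ s f (l s x)) := by
    intro x
    change _ = B.metric (l s x) (B.act s ((l s)⁻¹ (l s x), f ((l s)⁻¹ (l s x)))).2
      (B.act s ((l s)⁻¹ (l s x), f ((l s)⁻¹ (l s x)))).2
    rw [show (l s)⁻¹ (l s x) = x from (l s).symm_apply_apply x, B.act_isometry]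
  simp_rw [h]
  have h2 := integral_map (hμ s).measurable.aemeasurable (μ := μ)
    (f := fun x => B.metric x (B.preRep hμ s f x) (B.preRep hμ s f x))
    hm.aestronglyMeasurable
  rw [(hμ s).map_eq] at h2
  exact h2

/-- The induced representation `U(s) f = λ(s) ∘ f ∘ l_s⁻¹` on the `L²`-section space associated with
the Hermitian `G`-bundle `B` and the `G`-invariant measure `μ`. -/
def rep (hμ : ∀ s, MeasurePreserving (l s) μ μ) :
    G →* (B.L2Section μ ≃ₗᵢ[ℂ] B.L2Section μ) :=
  quotRep (B.preRep hμ) (B.norm_preRep hμ)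

end L2

end HermitianGBundle

/-! ### Induced representations

The coset space `G ⧸ K` carries the quotient σ-algebra (a set is measurable iff its preimage in `G`
is Borel); for a closed subgroup of a second countable Lie group this is the Borel σ-algebra of
`G ⧸ K`, see `CosetSpace.borelSpace`. -/

section Induced

instance quotientOpensMeasurableSpace {G : Type*} [Group G] [TopologicalSpace G]
    [MeasurableSpace G] [OpensMeasurableSpace G] (K : Subgroup G) :
    OpensMeasurableSpace (G ⧸ K) where
  borel_le := MeasurableSpace.generateFrom_le fun _ hs =>
    (hs.preimage QuotientGroup.continuous_mk).measurableSet

variable {G : Type*} [Group G] {K : Subgroup G}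
  {V : Type*} [NormedAddCommGroup V] [InnerProductSpace ℂ V] [CompleteSpace V]

/-- `f (g k) = σ(k)⁻¹ f(g)` for all `g ∈ G`, `k ∈ K`. -/
def IsCovariant (σ : K →* unitary (V →L[ℂ] V)) (f : G → V) : Prop :=
  ∀ (g : G) (k : K), f (g * k) = ((σ k)⁻¹ : unitary (V →L[ℂ] V)).1 (f g)

theorem unitary_inner (u : unitary (V →L[ℂ] V)) (v w : V) :
    inner ℂ (u.1 v) (u.1 w) = inner ℂ v w := by
  rw [← ContinuousLinearMap.adjoint_inner_right, ← ContinuousLinearMap.star_eq_adjoint,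
    ← mul_apply_eq_comp, Unitary.coe_star_mul_self, one_apply_eq_self]

/-- For covariant `f, f'` the function `g ↦ ⟨f g, f' g⟩` is constant on cosets, so that its value at
`gK` can be computed at the representative `(gK).out`. -/
theorem IsCovariant.inner_out {σ : K →* unitary (V →L[ℂ] V)} {f f' : G → V} (hf : IsCovariant σ f)
    (hf' : IsCovariant σ f') (g : G) :
    inner ℂ (f (g : G ⧸ K).out) (f' (g : G ⧸ K).out) = inner ℂ (f g) (f' g) := by
  obtain ⟨k, hk⟩ := QuotientGroup.mk_out_eq_mul K g
  rw [hk, hf, hf', unitary_inner]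

theorem IsCovariant.norm_out {σ : K →* unitary (V →L[ℂ] V)} {f : G → V} (hf : IsCovariant σ f)
    (g : G) : ‖f (g : G ⧸ K).out‖ = ‖f g‖ := by
  have := hf.inner_out hf g
  rw [inner_self_eq_norm_sq_to_K, inner_self_eq_norm_sq_to_K] at this
  have h2 : ‖f (g : G ⧸ K).out‖ ^ 2 = ‖f g‖ ^ 2 := by exact_mod_cast this
  exact (sq_eq_sq₀ (norm_nonneg _) (norm_nonneg _)).1 h2

variable [MeasurableSpace G] [MeasurableSpace V] [BorelSpace V]

theorem IsCovariant.measurable_enorm {σ : K →* unitary (V →L[ℂ] V)} {f : G → V}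
    (hf : IsCovariant σ f) (hm : Measurable f) : Measurable fun q : G ⧸ K => ‖f q.out‖ₑ := by
  refine QuotientGroup.measurable_from_quotient.2 ?_
  have : (fun q : G ⧸ K => ‖f q.out‖ₑ) ∘ ((↑) : G → G ⧸ K) = fun g => ‖f g‖ₑ := by
    funext g
    simp only [Function.comp, ← ofReal_norm, hf.norm_out g]
  rw [this]
  exact hm.enorm

variable [FiniteDimensional ℂ V]

theorem IsCovariant.measurable_inner {σ : K →* unitary (V →L[ℂ] V)} {f f' : G → V}
    (hf : IsCovariant σ f) (hf' : IsCovariant σ f') (hm : Measurable f) (hm' : Measurable f') :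
    Measurable fun q : G ⧸ K => inner ℂ (f q.out) (f' q.out) := by
  have : ProperSpace V := FiniteDimensional.proper ℂ V
  have : SecondCountableTopology V := secondCountable_of_proper
  refine QuotientGroup.measurable_from_quotient.2 ?_
  have : (fun q : G ⧸ K => inner ℂ (f q.out) (f' q.out)) ∘ ((↑) : G → G ⧸ K)
      = fun g => inner ℂ (f g) (f' g) := by
    funext g
    exact hf.inner_out hf' g
  rw [this]
  exact hm.inner hm'

/-- Borel functions `f : G → V` with `f (g k) = σ(k)⁻¹ f(g)` and
`∫_{G/K} ‖f(x)‖² dμ(xK) < ∞`. -/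
def indSubmodule (σ : K →* unitary (V →L[ℂ] V)) (μ : Measure (G ⧸ K)) :
    Submodule ℂ (G → V) where
  carrier := {f | Measurable f ∧ IsCovariant σ f ∧ ∫⁻ q : G ⧸ K, ‖f q.out‖ₑ ^ 2 ∂μ < ⊤}
  zero_mem' := ⟨measurable_const, fun g k => by simp, by simp⟩
  add_mem' := by
    have : ProperSpace V := FiniteDimensional.proper ℂ V
    have : SecondCountableTopology V := secondCountable_of_proper
    rintro f g ⟨hf, hf', hf''⟩ ⟨hg, hg', hg''⟩
    refine ⟨hf.add hg, fun x k => by simp [hf' x k, hg' x k], ?_⟩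
    calc ∫⁻ q : G ⧸ K, ‖(f + g) q.out‖ₑ ^ 2 ∂μ
        ≤ ∫⁻ q : G ⧸ K, (2 * ‖f q.out‖ₑ ^ 2 + 2 * ‖g q.out‖ₑ ^ 2) ∂μ := by
          refine lintegral_mono fun q => ?_
          have h2 : (2 : ENNReal) = ENNReal.ofReal 2 := by simp
          have e : ∀ v : V, ‖v‖ₑ ^ 2 = ENNReal.ofReal (‖v‖ ^ 2) := fun v => by
            rw [← ofReal_norm, ENNReal.ofReal_pow (norm_nonneg _)]
          rw [e, e, e, h2, ← ENNReal.ofReal_mul (by norm_num), ← ENNReal.ofReal_mul (by norm_num),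
            ← ENNReal.ofReal_add (by positivity) (by positivity)]
          refine ENNReal.ofReal_le_ofReal ?_
          have := norm_add_le (f q.out) (g q.out)
          have h0 := norm_nonneg (f q.out + g q.out)
          simp only [Pi.add_apply]
          nlinarith [sq_nonneg (‖f q.out‖ - ‖g q.out‖)]
      _ = 2 * ∫⁻ q : G ⧸ K, ‖f q.out‖ₑ ^ 2 ∂μ + 2 * ∫⁻ q : G ⧸ K, ‖g q.out‖ₑ ^ 2 ∂μ := by
          rw [lintegral_add_left (((hf'.measurable_enorm hf).pow_const 2).const_mul 2),
            lintegral_const_mul' _ _ (by simp), lintegral_const_mul' _ _ (by simp)]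
      _ < ⊤ := ENNReal.add_lt_top.2 ⟨ENNReal.mul_lt_top (by simp) hf'',
            ENNReal.mul_lt_top (by simp) hg''⟩
  smul_mem' := by
    rintro c f ⟨hf, hf', hf''⟩
    refine ⟨hf.const_smul c, fun x k => by simp [hf' x k], ?_⟩
    have : ∀ q : G ⧸ K, ‖(c • f) q.out‖ₑ ^ 2 = ‖c‖ₑ ^ 2 * ‖f q.out‖ₑ ^ 2 := fun q => by
      rw [Pi.smul_apply, enorm_smul, mul_pow]
    simp_rw [this]
    rw [lintegral_const_mul' _ _ (by simp)]
    exact ENNReal.mul_lt_top (by simp) hf''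

/-- The space `𝓕₀` of square-integrable covariant Borel functions, a pre-Hilbert space for
`⟨f, f'⟩ = ∫_{G/K} ⟨f(x), f'(x)⟩ dμ(xK)`. -/
def IndPre (σ : K →* unitary (V →L[ℂ] V)) (μ : Measure (G ⧸ K)) : Type _ := indSubmodule σ μ

variable (σ : K →* unitary (V →L[ℂ] V)) (μ : Measure (G ⧸ K))

instance : AddCommGroup (IndPre σ μ) := inferInstanceAs (AddCommGroup (indSubmodule σ μ))

instance : Module ℂ (IndPre σ μ) := inferInstanceAs (Module ℂ (indSubmodule σ μ))

/-- The underlying function on `G`. -/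
def IndPre.fn {σ : K →* unitary (V →L[ℂ] V)} {μ : Measure (G ⧸ K)} (f : IndPre σ μ) : G → V :=
  (indSubmodule σ μ).subtype f

instance : CoeFun (IndPre σ μ) (fun _ => G → V) := ⟨IndPre.fn⟩

/-- A square-integrable covariant Borel function as an element of `IndPre`. -/
def IndPre.mk {σ : K →* unitary (V →L[ℂ] V)} {μ : Measure (G ⧸ K)} (f : G → V)
    (hf : Measurable f) (hc : IsCovariant σ f)
    (hf' : ∫⁻ q : G ⧸ K, ‖f q.out‖ₑ ^ 2 ∂μ < ⊤) : IndPre σ μ :=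
  (⟨f, hf, hc, hf'⟩ : indSubmodule σ μ)

variable {σ μ} in
theorem IndPre.ext {f g : IndPre σ μ} (h : ∀ x, f x = g x) : f = g := Subtype.ext (funext h)

variable {σ μ} in
theorem IndPre.measurable (f : IndPre σ μ) : Measurable f := Subtype.property f |>.1

variable {σ μ} in
theorem IndPre.covariant (f : IndPre σ μ) : IsCovariant σ f := Subtype.property f |>.2.1

variable {σ μ} in
theorem IndPre.lintegral_lt_top (f : IndPre σ μ) :
    ∫⁻ q : G ⧸ K, ‖f q.out‖ₑ ^ 2 ∂μ < ⊤ := Subtype.property f |>.2.2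

theorem integrable_ind (f f' : IndPre σ μ) :
    Integrable (fun q : G ⧸ K => inner ℂ (f q.out) (f' q.out)) μ := by
  have key : ∀ f : IndPre σ μ, Integrable (fun q : G ⧸ K => ‖f q.out‖ ^ 2) μ := fun f => by
    have hm : Measurable fun q : G ⧸ K => ‖f q.out‖ ^ 2 := by
      have := ((f.covariant.measurable_enorm f.measurable).ennreal_toReal).pow_const 2
      simpa using this
    refine ⟨hm.aestronglyMeasurable, (hasFiniteIntegral_iff_ofReal
        (Filter.Eventually.of_forall fun x => by positivity)).2 ?_⟩
    have e : ∀ v : V, ENNReal.ofReal (‖v‖ ^ 2) = ‖v‖ₑ ^ 2 := fun v => by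
      rw [← ofReal_norm, ENNReal.ofReal_pow (norm_nonneg _)]
    simp_rw [e]
    exact f.lintegral_lt_top
  refine ((key f).add (key f')).mono'
    (f.covariant.measurable_inner f'.covariant f.measurable f'.measurable).aestronglyMeasurable
    (Filter.Eventually.of_forall fun q => ?_)
  have := norm_inner_le_norm (𝕜 := ℂ) (f q.out) (f' q.out)
  simp only [Pi.add_apply]
  nlinarith [sq_nonneg (‖f q.out‖ - ‖f' q.out‖), sq_nonneg (‖f q.out‖), sq_nonneg (‖f' q.out‖)]

/-- The inner product `∫_{G/K} ⟨f(x), f'(x)⟩ dμ(xK)`. -/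
@[reducible]
def indCore : PreInnerProductSpace.Core ℂ (IndPre σ μ) :=
  integralCore μ (fun f f' (q : G ⧸ K) => inner ℂ (f q.out) (f' q.out)) (integrable_ind σ μ)
    (fun _ _ _ => inner_conj_symm _ _) (fun _ _ => inner_self_nonneg (𝕜 := ℂ))
    (fun f g k q => inner_add_left (𝕜 := ℂ) (f q.out) (g q.out) (k q.out))
    (fun c f g q => inner_smul_left (𝕜 := ℂ) (f q.out) (g q.out) c)

instance : SeminormedAddCommGroup (IndPre σ μ) :=
  @InnerProductSpace.Core.toSeminormedAddCommGroup ℂ _ _ _ _ (indCore σ μ)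

instance : InnerProductSpace ℂ (IndPre σ μ) := InnerProductSpace.ofCore (indCore σ μ)

/-- The space `𝓕` of the induced representation: `𝓕₀` modulo functions of norm zero. -/
abbrev IndSpace : Type _ := SeparationQuotient (IndPre σ μ)

variable {μ} [MeasurableMul G]

/-- `[x f](y) = f (x⁻¹ y)` on `𝓕₀`. -/
def indPreRepFun (hμ : ∀ x : G, MeasurePreserving (fun q : G ⧸ K => x • q) μ μ) (x : G)
    (f : IndPre σ μ) : IndPre σ μ :=
  have hm : Measurable fun y => f (x⁻¹ * y) := f.measurable.comp (measurable_const_mul x⁻¹)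
  have hc : IsCovariant σ fun y => f (x⁻¹ * y) := fun y k => by
    have := f.covariant (x⁻¹ * y) k
    rwa [mul_assoc] at this
  IndPre.mk (fun y => f (x⁻¹ * y)) hm hc (by
    have h2 := f.lintegral_lt_top
    rw [← (hμ x).lintegral_comp ((hc.measurable_enorm hm).pow_const 2)]
    convert h2 using 2
    funext q
    obtain ⟨y, rfl⟩ := QuotientGroup.mk_surjective q
    congr 1
    rw [← ofReal_norm, ← ofReal_norm, f.covariant.norm_out y]
    have := hc.norm_out (x * y)
    rw [inv_mul_cancel_left] at this
    rw [← this]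
    rfl)

/-- The action `[x f](y) = f (x⁻¹ y)` of `G` on `𝓕₀`. -/
def indPreRep (hμ : ∀ x : G, MeasurePreserving (fun q : G ⧸ K => x • q) μ μ) :
    G →* Module.End ℂ (IndPre σ μ) where
  toFun x :=
    { toFun := indPreRepFun σ hμ x
      map_add' := fun _ _ => IndPre.ext fun _ => rfl
      map_smul' := fun _ _ => IndPre.ext fun _ => rfl }
  map_one' := LinearMap.ext fun f => IndPre.ext fun y => by
    change f (1⁻¹ * y) = f y
    simp
  map_mul' x z := LinearMap.ext fun f => IndPre.ext fun y => by
    change f ((x * z)⁻¹ * y) = f (z⁻¹ * (x⁻¹ * y))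
    rw [mul_inv_rev, mul_assoc]

theorem norm_indPreRep (hμ : ∀ x : G, MeasurePreserving (fun q : G ⧸ K => x • q) μ μ) (x : G)
    (f : IndPre σ μ) : ‖indPreRep σ hμ x f‖ = ‖f‖ := by
  set F := indPreRep σ hμ x f with hF
  have hm := F.covariant.measurable_inner F.covariant F.measurable F.measurable
  change √(RCLike.re (∫ q : G ⧸ K, inner ℂ (F q.out) (F q.out) ∂μ))
    = √(RCLike.re (∫ q : G ⧸ K, inner ℂ (f q.out) (f q.out) ∂μ))
  congr 2
  have h : ∀ q : G ⧸ K, inner ℂ (f q.out) (f q.out)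
      = inner ℂ (F (x • q).out) (F (x • q).out) := by
    intro q
    obtain ⟨y, rfl⟩ := QuotientGroup.mk_surjective q
    rw [f.covariant.inner_out f.covariant y]
    have h1 := F.covariant.inner_out F.covariant (x * y)
    have h2 : F (x * y) = f y := by
      change f (x⁻¹ * (x * y)) = f y
      rw [inv_mul_cancel_left]
    rw [h2] at h1
    exact h1.symm
  simp_rw [h]
  have h2 := integral_map (hμ x).measurable.aemeasurable (μ := μ)
    (f := fun q : G ⧸ K => inner ℂ (F q.out) (F q.out)) hm.aestronglyMeasurable
  rw [(hμ x).map_eq] at h2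
  exact h2

/-- The induced representation `Ind_K^G σ`, realised with the `G`-invariant measure `μ` on `G/K`. -/
def indRep (hμ : ∀ x : G, MeasurePreserving (fun q : G ⧸ K => x • q) μ μ) :
    G →* (IndSpace σ μ ≃ₗᵢ[ℂ] IndSpace σ μ) :=
  quotRep (indPreRep σ hμ) (norm_indPreRep σ hμ)

end Induced

/-! ### Semidirect products, little groups and the two bundles -/

section Semidirect

variable {G : Type*} [Group G]

/-- The multiplication map `N × H → G`, `(n, h) ↦ n h`. -/
def mulMap (N H : Subgroup G) : N × H → G := fun p => p.1 * p.2

/-- The Lie group `G` is the semidirect product `N ⋉ H` of its closed subgroups `N` (abelian; that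
`N` is normal is a separate hypothesis) and `H`: the map `(n, h) ↦ n h` is a diffeomorphism of
`N × H` onto `G`. -/
structure IsLieSemidirect {EG EN EH : Type*} [NormedAddCommGroup EG] [NormedSpace ℝ EG]
    [NormedAddCommGroup EN] [NormedSpace ℝ EN] [NormedAddCommGroup EH] [NormedSpace ℝ EH]
    [TopologicalSpace G] [ChartedSpace EG G] (N H : Subgroup G)
    [ChartedSpace EN N] [ChartedSpace EH H] : Prop where
  isClosed_N : IsClosed (N : Set G)
  isClosed_H : IsClosed (H : Set G)
  comm : ∀ a b : N, a * b = b * a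
  diffeo : ∃ e : Diffeomorph (𝓘(ℝ, EN).prod 𝓘(ℝ, EH)) 𝓘(ℝ, EG) (N × H) G ∞, ⇑e = mulMap N H

theorem IsLieSemidirect.bijective {EG EN EH : Type*} [NormedAddCommGroup EG] [NormedSpace ℝ EG]
    [NormedAddCommGroup EN] [NormedSpace ℝ EN] [NormedAddCommGroup EH] [NormedSpace ℝ EH]
    [TopologicalSpace G] [ChartedSpace EG G] {N H : Subgroup G}
    [ChartedSpace EN N] [ChartedSpace EH H] (h : IsLieSemidirect (EG := EG) (EN := EN) (EH := EH) N H) :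
    Function.Bijective (mulMap N H) := by
  obtain ⟨e, he⟩ := h.diffeo
  rw [← he]
  exact e.bijective

variable {N H : Subgroup G}

/-- The component `n` of `g = n h`. -/
def nPart (hNH : Function.Bijective (mulMap N H)) (g : G) : N :=
  ((Equiv.ofBijective _ hNH).symm g).1

/-- The component `h` of `g = n h`. -/
def hPart (hNH : Function.Bijective (mulMap N H)) (g : G) : H :=
  ((Equiv.ofBijective _ hNH).symm g).2

theorem nPart_mul_hPart (hNH : Function.Bijective (mulMap N H)) (g : G) :
    (nPart hNH g : G) * hPart hNH g = g :=
  (Equiv.ofBijective _ hNH).apply_symm_apply g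

theorem parts_eq (hNH : Function.Bijective (mulMap N H)) {g : G} {n : N} {h : H}
    (hg : (n : G) * h = g) : nPart hNH g = n ∧ hPart hNH g = h := by
  have : (Equiv.ofBijective _ hNH).symm g = (n, h) := by
    rw [Equiv.symm_apply_eq]
    exact hg.symm
  simp [nPart, hPart, this]

theorem parts_one (hNH : Function.Bijective (mulMap N H)) :
    nPart hNH 1 = 1 ∧ hPart hNH 1 = 1 := parts_eq hNH (by simp)

variable [N.Normal]

theorem parts_mul (hNH : Function.Bijective (mulMap N H)) (s t : G) :
    nPart hNH (s * t) = nPart hNH s * MulAut.conjNormal (hPart hNH s : G) (nPart hNH t) ∧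
      hPart hNH (s * t) = hPart hNH s * hPart hNH t := by
  refine parts_eq hNH ?_
  simp only [Subgroup.coe_mul, MulAut.conjNormal_apply]
  conv_rhs => rw [← nPart_mul_hPart hNH s, ← nPart_mul_hPart hNH t]
  group

/-- The projection `n h ↦ h` as a group homomorphism. -/
def hPartHom (hNH : Function.Bijective (mulMap N H)) : G →* H where
  toFun := hPart hNH
  map_one' := (parts_one hNH).2
  map_mul' s t := (parts_mul hNH s t).2

/-- The isotropy group `G_ν = {x | x · ν = ν}` of a character `ν` of `N`, where
`(x · ν)(n) = ν (x⁻¹ n x)`. -/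
def isotropy (ν : N →* Circle) : Subgroup G where
  carrier := {x | ∀ n : N, ν (MulAut.conjNormal x⁻¹ n) = ν n}
  one_mem' n := by simp
  mul_mem' := by
    intro a b ha hb n
    rw [mul_inv_rev, map_mul, MulAut.mul_apply, hb, ha]
  inv_mem' := by
    intro a ha n
    have := ha (MulAut.conjNormal a n)
    rw [← MulAut.mul_apply, ← map_mul, inv_mul_cancel, map_one, MulAut.one_apply] at this
    rw [inv_inv, this]

variable (H) in
/-- The little group `H_ν = H ∩ G_ν`, as a subgroup of `H`. -/
def littleGroup (ν : N →* Circle) : Subgroup H := (isotropy ν).subgroupOf H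

theorem coe_mem_isotropy (ν : N →* Circle) (n : N) : (n : G) ∈ isotropy ν := by
  intro m
  have : (MulAut.conjNormal (n : G)⁻¹ m : N) = n⁻¹ * m * n := by
    ext
    simp
  rw [this, map_mul, map_mul, map_inv, mul_right_comm, inv_mul_cancel, one_mul]

theorem hPart_mem_littleGroup (hNH : Function.Bijective (mulMap N H)) {ν : N →* Circle} {g : G}
    (hg : g ∈ isotropy ν) : hPart hNH g ∈ littleGroup H ν := by
  change (hPart hNH g : G) ∈ isotropy ν
  have : (hPart hNH g : G) = (nPart hNH g : G)⁻¹ * g := by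
    rw [eq_inv_mul_iff_mul_eq, nPart_mul_hPart]
  rw [this]
  exact mul_mem (inv_mem (coe_mem_isotropy ν _)) hg

/-- The action of `G = N ⋉ H` on `H / H_ν`, through `H`: `l_{nh}(y H_ν) = h y H_ν`. -/
def baseAction (hNH : Function.Bijective (mulMap N H)) (ν : N →* Circle) :
    G →* Equiv.Perm (H ⧸ littleGroup H ν) :=
  (MulAction.toPermHom H (H ⧸ littleGroup H ν)).comp (hPartHom hNH)

/-- The bijection `H / H_ν → G / G_ν`, `h H_ν ↦ h G_ν`. -/
def cosetMap (H : Subgroup G) (ν : N →* Circle) : H ⧸ littleGroup H ν → G ⧸ isotropy ν :=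
  Quotient.map' (fun h : H => (h : G)) fun a b hab => by
    rw [QuotientGroup.leftRel_apply] at hab ⊢
    exact hab

/-- The function `y H_ν ↦ ν (y⁻¹ n y)` on `H / H_ν`. -/
def charTwist (ν : N →* Circle) (n : N) : H ⧸ littleGroup H ν → Circle :=
  Quotient.lift (fun y : H => ν (MulAut.conjNormal (y : G)⁻¹ n)) fun a b hab => by
    have hab' : a⁻¹ * b ∈ littleGroup H ν := QuotientGroup.leftRel_apply.1 hab
    have h : ((a⁻¹ * b : H) : G) ∈ isotropy ν := hab'
    have h2 := h (MulAut.conjNormal (a : G)⁻¹ n)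
    rw [← MulAut.mul_apply, ← map_mul] at h2
    rw [← h2]
    congr 3
    simp

theorem charTwist_mk (ν : N →* Circle) (n : N) (y : H) :
    charTwist ν n (y : H ⧸ littleGroup H ν) = ν (MulAut.conjNormal (y : G)⁻¹ n) := rfl

theorem charTwist_one (ν : N →* Circle) (q : H ⧸ littleGroup H ν) : charTwist ν 1 q = 1 := by
  obtain ⟨y, rfl⟩ := QuotientGroup.mk_surjective q
  simp [charTwist_mk]

theorem charTwist_mul (ν : N →* Circle) (n m : N) (q : H ⧸ littleGroup H ν) :
    charTwist ν (n * m) q = charTwist ν n q * charTwist ν m q := by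
  obtain ⟨y, rfl⟩ := QuotientGroup.mk_surjective q
  simp [charTwist_mk]

theorem charTwist_conj (ν : N →* Circle) (h : H) (n : N) (q : H ⧸ littleGroup H ν) :
    charTwist ν (MulAut.conjNormal (h : G) n) (h • q) = charTwist ν n q := by
  obtain ⟨y, rfl⟩ := QuotientGroup.mk_surjective q
  rw [MulAction.Quotient.smul_coe, charTwist_mk, charTwist_mk, ← MulAut.mul_apply, ← map_mul]
  congr 3
  simp

variable {V : Type*} [NormedAddCommGroup V] [InnerProductSpace ℂ V] [CompleteSpace V]

/-- A complex number of modulus one as a unitary operator. -/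
def circleUnitary (V : Type*) [NormedAddCommGroup V] [InnerProductSpace ℂ V] [CompleteSpace V] :
    Circle →* unitary (V →L[ℂ] V) where
  toFun z := ⟨(z : ℂ) • 1, by
    have h : conj (z : ℂ) * z = 1 := by
      rw [← Complex.normSq_eq_conj_mul_self]; simp
    have h' : (z : ℂ) * conj (z : ℂ) = 1 := by rw [mul_comm, h]
    constructor
    · simp [star_smul, smul_smul, h']
    · simp [star_smul, smul_smul, h]⟩
  map_one' := by ext; simp
  map_mul' a b := by
    ext v
    simp [smul_smul, mul_comm]

theorem circleUnitary_apply (z : Circle) (v : V) : (circleUnitary V z).1 v = (z : ℂ) • v := rfl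

/-- The representation `ν σ : G_ν → U(V)`, `(ν σ)(n h) = ν(n) σ(h)` for `n ∈ N`, `h ∈ H_ν`. -/
def nuSigma (hNH : Function.Bijective (mulMap N H)) (ν : N →* Circle)
    (σ : littleGroup H ν →* unitary (V →L[ℂ] V)) : isotropy ν →* unitary (V →L[ℂ] V) where
  toFun g := circleUnitary V (ν (nPart hNH g)) * σ ⟨hPart hNH g, hPart_mem_littleGroup hNH g.2⟩
  map_one' := by
    have h1 : nPart hNH ((1 : isotropy ν) : G) = 1 := (parts_one hNH).1
    have h2 : (⟨hPart hNH ((1 : isotropy ν) : G), hPart_mem_littleGroup hNH (one_mem _)⟩ :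
      littleGroup H ν) = 1 := Subtype.ext (parts_one hNH).2
    rw [h1, h2]
    simp
  map_mul' s t := by
    have h1 : ν (nPart hNH ((s * t : isotropy ν) : G)) = ν (nPart hNH s) * ν (nPart hNH t) := by
      have := inv_mem (hPart_mem_littleGroup hNH s.2) (nPart hNH (t : G))
      rw [Subgroup.coe_mul, (parts_mul hNH s t).1, map_mul]
      simpa using this
    have h2 : (⟨hPart hNH ((s * t : isotropy ν) : G), hPart_mem_littleGroup hNH (s * t).2⟩ :
        littleGroup H ν) = ⟨hPart hNH s, hPart_mem_littleGroup hNH s.2⟩ *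
          ⟨hPart hNH t, hPart_mem_littleGroup hNH t.2⟩ := Subtype.ext (parts_mul hNH s t).2
    rw [h1, h2, map_mul, map_mul]
    have hc : ∀ (z : Circle) (u : unitary (V →L[ℂ] V)),
        u * circleUnitary V z = circleUnitary V z * u := by
      intro z u
      ext v
      simp [circleUnitary]
    simp only [mul_assoc]
    rw [← mul_assoc (σ _) (circleUnitary V _), hc, mul_assoc]

/-- The sesquilinear form `(v, w) ↦ ⟨v, A w⟩`. -/
def formOf (A : V →L[ℂ] V) : V →ₗ⋆[ℂ] V →ₗ[ℂ] ℂ :=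
  LinearMap.mk₂'ₛₗ (starRingEnd ℂ) (RingHom.id ℂ) (fun v w => inner ℂ v (A w))
    (fun _ _ _ => inner_add_left _ _ _) (fun _ _ _ => inner_smul_left _ _ _)
    (fun _ _ _ => by rw [map_add, inner_add_right])
    (fun _ _ _ => by rw [map_smul, inner_smul_right]; rfl)

theorem formOf_apply (A : V →L[ℂ] V) (v w : V) : formOf A v w = inner ℂ v (A w) := rfl

section Perception

variable {ν : N →* Circle} {σ : littleGroup H ν →* unitary (V →L[ℂ] V)}
  {Φ : H →* (V →L[ℂ] V)ˣ}

/-- The operator `Φ(x)^{†-1} Φ(x)^{-1}`, a function of the coset `x H_ν` because the restriction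
`σ` of `Φ` to `H_ν` is unitary. -/
def perceptionOp (hΦσ : ∀ k : littleGroup H ν, (Φ k : V →L[ℂ] V) = σ k) :
    H ⧸ littleGroup H ν → V →L[ℂ] V :=
  Quotient.lift (fun x : H => (((star (Φ x))⁻¹ * (Φ x)⁻¹ : (V →L[ℂ] V)ˣ) : V →L[ℂ] V))
    fun a b hab => by
      have hab' : a⁻¹ * b ∈ littleGroup H ν := QuotientGroup.leftRel_apply.1 hab
      obtain ⟨k, hk⟩ : ∃ k : littleGroup H ν, b = a * k := ⟨⟨_, hab'⟩, by simp⟩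
      have h1 : Φ k * star (Φ k) = 1 := by
        ext1
        simp [hΦσ]
      congr 1
      rw [hk, map_mul, ← mul_inv_rev, ← mul_inv_rev, star_mul, mul_assoc,
        ← mul_assoc (Φ (k : H)), h1, one_mul]

theorem formOf_perceptionOp_mk (hΦσ : ∀ k : littleGroup H ν, (Φ k : V →L[ℂ] V) = σ k) (x : H)
    (v w : V) : formOf (perceptionOp hΦσ x) v w
      = inner ℂ ((Φ x⁻¹ : V →L[ℂ] V) v) ((Φ x⁻¹ : V →L[ℂ] V) w) := by
  change inner ℂ v ((((star (Φ x))⁻¹ * (Φ x)⁻¹ : (V →L[ℂ] V)ˣ) : V →L[ℂ] V) w) = _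
  rw [← star_inv, ← map_inv, Units.val_mul, mul_apply_eq_comp, Units.coe_star,
    ContinuousLinearMap.star_eq_adjoint, ContinuousLinearMap.adjoint_inner_right]

variable [TopologicalSpace G] [IsTopologicalGroup G]

theorem continuous_charTwist (hν : Continuous ν) (n : N) :
    Continuous (charTwist (H := H) ν n) := by
  refine QuotientGroup.isOpenQuotientMap_mk.isQuotientMap.continuous_iff.2 ?_
  change Continuous fun y : H => ν (MulAut.conjNormal (y : G)⁻¹ n)
  have h : Continuous fun y : H => (y : G)⁻¹ * n * y := by fun_prop
  refine hν.comp (continuous_induced_rng.2 ?_)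
  refine h.congr fun y => ?_
  simp

/-- The perception bundle `E_σ`: the product bundle `H/H_ν × V` with the metric
`h((xH_ν, v), (xH_ν, w)) = ⟨v, Φ(x)^{†-1} Φ(x)^{-1} w⟩` and the action
`λ(n h)(yH_ν, v) = (h y H_ν, ν((h y)⁻¹ n h y) Φ(h) v)`. -/
def perceptionBundle (hNH : Function.Bijective (mulMap N H)) (hν : Continuous ν)
    (hΦ : Continuous fun x => (Φ x : V →L[ℂ] V))
    (hΦσ : ∀ k : littleGroup H ν, (Φ k : V →L[ℂ] V) = σ k) :
    HermitianGBundle (baseAction hNH ν) V where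
  metric x := formOf (perceptionOp hΦσ x)
  metric_symm q v w := by
    obtain ⟨x, rfl⟩ := QuotientGroup.mk_surjective q
    rw [formOf_perceptionOp_mk, formOf_perceptionOp_mk, inner_conj_symm]
  metric_pos q v hv := by
    obtain ⟨x, rfl⟩ := QuotientGroup.mk_surjective q
    rw [formOf_perceptionOp_mk]
    have h : (Φ x⁻¹ : V →L[ℂ] V) v ≠ 0 := by
      intro h0
      apply hv
      have : (Φ x : V →L[ℂ] V) ((Φ x⁻¹ : V →L[ℂ] V) v) = v := by
        rw [← mul_apply_eq_comp, ← Units.val_mul, ← map_mul]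
        simp
      rw [← this, h0, map_zero]
    exact (re_inner_self_pos (𝕜 := ℂ)).2 h
  continuous_metric := by
    have hq := ((QuotientGroup.isOpenQuotientMap_mk (N := littleGroup H ν)).prodMap
      (IsOpenQuotientMap.id (X := V × V))).isQuotientMap
    refine hq.continuous_iff.2 ?_
    have : ((fun p : (H ⧸ littleGroup H ν) × V × V => formOf (perceptionOp hΦσ p.1) p.2.1 p.2.2) ∘
        Prod.map (QuotientGroup.mk : H → H ⧸ littleGroup H ν) id)
        = fun p : H × V × V =>
          inner ℂ ((Φ p.1⁻¹ : V →L[ℂ] V) p.2.1) ((Φ p.1⁻¹ : V →L[ℂ] V) p.2.2) := by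
      funext p
      exact formOf_perceptionOp_mk hΦσ p.1 p.2.1 p.2.2
    rw [this]
    have h2 : Continuous fun p : H × V × V => (Φ p.1⁻¹ : V →L[ℂ] V) :=
      hΦ.comp continuous_fst.inv
    exact (h2.clm_apply (by fun_prop)).inner (h2.clm_apply (by fun_prop))
  act := MonoidHom.toHomPerm
    { toFun := fun s p => (hPart hNH s • p.1,
        (charTwist ν (nPart hNH s) (hPart hNH s • p.1) : ℂ) • (Φ (hPart hNH s) : V →L[ℂ] V) p.2)
      map_one' := by
        funext p
        rw [(parts_one hNH).1, (parts_one hNH).2]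
        refine Prod.ext (one_smul _ _) ?_
        change _ = p.2
        simp [charTwist_one]
      map_mul' := fun s t => by
        funext p
        rw [(parts_mul hNH s t).1, (parts_mul hNH s t).2]
        refine Prod.ext (mul_smul _ _ _) ?_
        change _ = (charTwist ν (nPart hNH s) (hPart hNH s • hPart hNH t • p.1) : ℂ) •
          (Φ (hPart hNH s) : V →L[ℂ] V) ((charTwist ν (nPart hNH t) (hPart hNH t • p.1) : ℂ) •
            (Φ (hPart hNH t) : V →L[ℂ] V) p.2)
        rw [charTwist_mul, mul_smul (hPart hNH s) (hPart hNH t) p.1, charTwist_conj, map_smul,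
          map_mul, Units.val_mul, mul_apply_eq_comp, Circle.coe_mul, mul_smul] }
  act_fst _ _ := rfl
  act_add s x v w := by
    change _ • _ = _ • _ + _ • _
    rw [map_add, smul_add]
  act_smul s x c v := by
    change _ • _ = c • _ • _
    rw [map_smul, smul_comm]
  act_isometry s q v w := by
    obtain ⟨x, rfl⟩ := QuotientGroup.mk_surjective q
    change formOf (perceptionOp hΦσ ((hPart hNH s * x : H) : H ⧸ littleGroup H ν))
      ((_ : ℂ) • _) ((_ : ℂ) • _) = _
    rw [formOf_perceptionOp_mk, formOf_perceptionOp_mk]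
    have h : ∀ v, (Φ (hPart hNH s * x)⁻¹ : V →L[ℂ] V) ((Φ (hPart hNH s) : V →L[ℂ] V) v)
        = (Φ x⁻¹ : V →L[ℂ] V) v := fun v => by
      rw [← mul_apply_eq_comp, ← Units.val_mul, ← map_mul]
      simp
    rw [map_smul, map_smul, ← circleUnitary_apply, ← circleUnitary_apply, unitary_inner, h, h]
  continuous_act s := by
    have h1 : Continuous fun p : (H ⧸ littleGroup H ν) × V => hPart hNH s • p.1 :=
      (continuous_const_smul _).comp continuous_fst
    have h2 : Continuous fun p : (H ⧸ littleGroup H ν) × V =>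
        (charTwist ν (nPart hNH s) (hPart hNH s • p.1) : ℂ) :=
      continuous_subtype_val.comp ((continuous_charTwist hν _).comp h1)
    exact h1.prodMk (h2.smul ((Φ (hPart hNH s) : V →L[ℂ] V).continuous.comp continuous_snd))

theorem perceptionBundle_act (hNH : Function.Bijective (mulMap N H)) (hν : Continuous ν)
    (hΦ : Continuous fun x => (Φ x : V →L[ℂ] V))
    (hΦσ : ∀ k : littleGroup H ν, (Φ k : V →L[ℂ] V) = σ k) (n : N) (h y : H) (v : V) :
    (perceptionBundle hNH hν hΦ hΦσ).act (n * h) ((y : H ⧸ littleGroup H ν), v)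
      = (((h * y : H) : H ⧸ littleGroup H ν),
          (ν (MulAut.conjNormal ((h * y : H) : G)⁻¹ n) : ℂ) • (Φ h : V →L[ℂ] V) v) := by
  obtain ⟨h1, h2⟩ := parts_eq hNH (g := n * h) rfl
  change (hPart hNH (n * h) • (y : H ⧸ littleGroup H ν),
    (charTwist ν (nPart hNH (n * h)) (hPart hNH (n * h) • (y : H ⧸ littleGroup H ν)) : ℂ) •
      (Φ (hPart hNH (n * h)) : V →L[ℂ] V) v) = _
  rw [h1, h2]
  rfl

end Perception

section Boosting

variable {ν : N →* Circle}

/-- The Wigner transformation `W_L(x, yH_ν) = L(x y H_ν)⁻¹ x L(y H_ν)`, an element of `H_ν`. -/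
def wigner {L : H ⧸ littleGroup H ν → H} (hL : ∀ q, (L q : H ⧸ littleGroup H ν) = q)
    (x : H) (q : H ⧸ littleGroup H ν) : littleGroup H ν :=
  ⟨(L (x • q))⁻¹ * x * L q, by
    rw [mul_assoc, ← QuotientGroup.eq, hL, ← smul_eq_mul, ← MulAction.Quotient.smul_coe, hL]⟩

theorem wigner_one {L : H ⧸ littleGroup H ν → H} (hL : ∀ q, (L q : H ⧸ littleGroup H ν) = q)
    (q : H ⧸ littleGroup H ν) : wigner hL 1 q = 1 := by
  ext
  simp [wigner]

theorem wigner_mul {L : H ⧸ littleGroup H ν → H} (hL : ∀ q, (L q : H ⧸ littleGroup H ν) = q)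
    (x y : H) (q : H ⧸ littleGroup H ν) :
    wigner hL (x * y) q = wigner hL x (y • q) * wigner hL y q := by
  refine Subtype.ext ?_
  simp only [wigner, mul_smul, Subgroup.coe_mul]
  group

variable [TopologicalSpace G] [IsTopologicalGroup G]

/-- The boosting bundle `E_{L,σ}`: the product bundle `H/H_ν × V` with the metric
`h_L((xH_ν, v), (xH_ν, w)) = ⟨v, w⟩` and the action
`λ_L(n h)(yH_ν, v) = (h y H_ν, ν((h y)⁻¹ n h y) σ(W_L(h, yH_ν)) v)`. -/
def boostingBundle (hNH : Function.Bijective (mulMap N H)) (hν : Continuous ν)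
    {σ : littleGroup H ν →* unitary (V →L[ℂ] V)}
    (hσ : Continuous fun k => (σ k : V →L[ℂ] V))
    {L : H ⧸ littleGroup H ν → H} (hLc : Continuous L)
    (hL : ∀ q, (L q : H ⧸ littleGroup H ν) = q) :
    HermitianGBundle (baseAction hNH ν) V where
  metric _ := formOf (1 : V →L[ℂ] V)
  metric_symm _ v w := by simp [formOf_apply]
  metric_pos _ v hv := by
    rw [formOf_apply]
    exact (re_inner_self_pos (𝕜 := ℂ)).2 hv
  continuous_metric := by
    simp only [formOf_apply, one_apply_eq_self]
    fun_prop
  act := MonoidHom.toHomPerm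
    { toFun := fun s p => (hPart hNH s • p.1,
        (charTwist ν (nPart hNH s) (hPart hNH s • p.1) : ℂ) •
          (σ (wigner hL (hPart hNH s) p.1) : V →L[ℂ] V) p.2)
      map_one' := by
        funext p
        rw [(parts_one hNH).1, (parts_one hNH).2]
        refine Prod.ext (one_smul _ _) ?_
        change _ = p.2
        simp [charTwist_one, wigner_one]
      map_mul' := fun s t => by
        funext p
        rw [(parts_mul hNH s t).1, (parts_mul hNH s t).2]
        refine Prod.ext (mul_smul _ _ _) ?_
        change _ = (charTwist ν (nPart hNH s) (hPart hNH s • hPart hNH t • p.1) : ℂ) •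
          (σ (wigner hL (hPart hNH s) (hPart hNH t • p.1)) : V →L[ℂ] V)
            ((charTwist ν (nPart hNH t) (hPart hNH t • p.1) : ℂ) •
              (σ (wigner hL (hPart hNH t) p.1) : V →L[ℂ] V) p.2)
        rw [charTwist_mul, wigner_mul, mul_smul (hPart hNH s) (hPart hNH t) p.1, charTwist_conj,
          map_smul, map_mul, Submonoid.coe_mul, mul_apply_eq_comp, Circle.coe_mul, mul_smul] }
  act_fst _ _ := rfl
  act_add s x v w := by
    change _ • _ = _ • _ + _ • _
    rw [map_add, smul_add]
  act_smul s x c v := by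
    change _ • _ = c • _ • _
    rw [map_smul, smul_comm]
  act_isometry s q v w := by
    change formOf (1 : V →L[ℂ] V) ((_ : ℂ) • (σ _ : V →L[ℂ] V) v) ((_ : ℂ) • (σ _ : V →L[ℂ] V) w)
      = _
    simp only [formOf_apply, one_apply_eq_self]
    rw [← circleUnitary_apply, ← circleUnitary_apply, unitary_inner, unitary_inner]
  continuous_act s := by
    have h1 : Continuous fun p : (H ⧸ littleGroup H ν) × V => hPart hNH s • p.1 :=
      (continuous_const_smul _).comp continuous_fst
    have h2 : Continuous fun p : (H ⧸ littleGroup H ν) × V =>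
        (charTwist ν (nPart hNH s) (hPart hNH s • p.1) : ℂ) :=
      continuous_subtype_val.comp ((continuous_charTwist hν _).comp h1)
    have h3 : Continuous fun p : (H ⧸ littleGroup H ν) × V => wigner hL (hPart hNH s) p.1 := by
      refine Continuous.subtype_mk ?_ _
      exact ((hLc.comp h1).inv.mul continuous_const).mul (hLc.comp continuous_fst)
    exact h1.prodMk (h2.smul ((hσ.comp h3).clm_apply continuous_snd))

theorem boostingBundle_act (hNH : Function.Bijective (mulMap N H)) (hν : Continuous ν)
    {σ : littleGroup H ν →* unitary (V →L[ℂ] V)}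
    (hσ : Continuous fun k => (σ k : V →L[ℂ] V))
    {L : H ⧸ littleGroup H ν → H} (hLc : Continuous L)
    (hL : ∀ q, (L q : H ⧸ littleGroup H ν) = q) (n : N) (h y : H) (v : V) :
    (boostingBundle hNH hν hσ hLc hL).act (n * h) ((y : H ⧸ littleGroup H ν), v)
      = (((h * y : H) : H ⧸ littleGroup H ν),
          (ν (MulAut.conjNormal ((h * y : H) : G)⁻¹ n) : ℂ) •
            (σ (wigner hL h (y : H ⧸ littleGroup H ν)) : V →L[ℂ] V) v) := by
  obtain ⟨h1, h2⟩ := parts_eq hNH (g := n * h) rfl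
  change (hPart hNH (n * h) • (y : H ⧸ littleGroup H ν),
    (charTwist ν (nPart hNH (n * h)) (hPart hNH (n * h) • (y : H ⧸ littleGroup H ν)) : ℂ) •
      (σ (wigner hL (hPart hNH (n * h)) (y : H ⧸ littleGroup H ν)) : V →L[ℂ] V) v) = _
  rw [h1, h2]
  rfl

/-- The map `α : (xH_ν, v) ↦ (xH_ν, Φ(L(xH_ν)⁻¹) v)`. -/
def boostMap (Φ : H →* (V →L[ℂ] V)ˣ) (L : H ⧸ littleGroup H ν → H) :
    (H ⧸ littleGroup H ν) × V → (H ⧸ littleGroup H ν) × V :=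
  fun p => (p.1, (Φ (L p.1)⁻¹ : V →L[ℂ] V) p.2)

end Boosting

section InvariantMeasure

variable {ν : N →* Circle}

theorem cosetMap_baseAction (hNH : Function.Bijective (mulMap N H)) (g : G)
    (q : H ⧸ littleGroup H ν) : cosetMap H ν (baseAction hNH ν g q) = g • cosetMap H ν q := by
  obtain ⟨y, rfl⟩ := QuotientGroup.mk_surjective q
  change ((hPart hNH g * y : G) : G ⧸ isotropy ν) = ((g * y : G) : G ⧸ isotropy ν)
  rw [QuotientGroup.eq]
  have : ((hPart hNH g : G) * y)⁻¹ * ((nPart hNH g : G) * hPart hNH g * y)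
      = (MulAut.conjNormal ((hPart hNH g : G) * y)⁻¹ (nPart hNH g) : N) := by
    simp only [MulAut.conjNormal_apply]
    group
  rw [nPart_mul_hPart] at this
  rw [this]
  exact coe_mem_isotropy ν _

variable [MeasurableSpace G]

theorem measurable_cosetMap : Measurable (cosetMap H ν) :=
  QuotientGroup.measurable_from_quotient.2
    (QuotientGroup.measurable_coe.comp measurable_subtype_coe)

variable [MeasurableMul G]

/-- An `H`-invariant measure on `H/H_ν` is invariant under the action of `G`. -/
theorem measurePreserving_baseAction (hNH : Function.Bijective (mulMap N H))
    (μ : Measure (H ⧸ littleGroup H ν)) [SMulInvariantMeasure H (H ⧸ littleGroup H ν) μ] (g : G) :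
    MeasurePreserving (baseAction hNH ν g) μ μ := by
  have hm : Measurable (baseAction hNH ν g) := by
    refine QuotientGroup.measurable_from_quotient.2 ?_
    have : Measurable fun y : H => hPart hNH g * y :=
      ((measurable_const_mul (hPart hNH g : G)).comp measurable_subtype_coe).subtype_mk
    exact QuotientGroup.measurable_coe.comp this
  refine ⟨hm, Measure.ext fun s hs => ?_⟩
  rw [Measure.map_apply hm hs]
  exact SMulInvariantMeasure.measure_preimage_smul (hPart hNH g) hs

/-- The measure on `G/G_ν` corresponding to `μ` under `H/H_ν ≅ G/G_ν` is `G`-invariant. -/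
theorem measurePreserving_cosetMap (hNH : Function.Bijective (mulMap N H))
    (μ : Measure (H ⧸ littleGroup H ν)) [SMulInvariantMeasure H (H ⧸ littleGroup H ν) μ] (g : G) :
    MeasurePreserving (fun q : G ⧸ isotropy ν => g • q) (μ.map (cosetMap H ν))
      (μ.map (cosetMap H ν)) := by
  have hm : Measurable fun q : G ⧸ isotropy ν => g • q := by
    refine QuotientGroup.measurable_from_quotient.2 ?_
    exact QuotientGroup.measurable_coe.comp (measurable_const_mul g)
  refine ⟨hm, ?_⟩
  rw [Measure.map_map hm measurable_cosetMap]
  have : (fun q : G ⧸ isotropy ν => g • q) ∘ cosetMap H ν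
      = cosetMap H ν ∘ baseAction hNH ν g := by
    funext q
    exact (cosetMap_baseAction hNH g q).symm
  have hb := measurePreserving_baseAction hNH μ g
  rw [this, ← Measure.map_map measurable_cosetMap hb.measurable, hb.map_eq]

end InvariantMeasure

end Semidirect

end

/-!
The map `α` conjugates the action, and carries the metric, of the perception bundle to those of the
boosting bundle, so that smoothness of the former passes to the latter and `φ ↦ α ∘ φ` is a unitary
equivalence. The boosting bundle has the constant metric of `V`, so its square-integrable sections
are those of `L²(μ; V) = L²(μ) ⊗ V`. Composing the section `L` with `H → G` gives a section of
`G → G / G_ν`, and restricting covariant functions along it identifies the induced representation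
with `U_L`: the isotropy cocycle of this section at `n h` is `L(hq)⁻¹ n L(hq) · W_L(h, q)`, on which
`νσ` takes the value that defines `λ_L`. Completeness and strong continuity are therefore only
checked for `U_L`, where they are those of `L²(μ; V)` and of translations acting on it.
-/

/-! ### Representations on separated spaces -/

section SeparatedSpace

variable {𝕜 X Y : Type*} [NormedField 𝕜] [SeminormedAddCommGroup X] [NormedSpace 𝕜 X]

/-- The isometric isomorphism from the separated space of `X` onto a normed space `Y` induced by a
surjective linear isometry `X → Y`. -/
noncomputable def separationLiftEquiv [NormedAddCommGroup Y] [NormedSpace 𝕜 Y] (A : X →ₗᵢ[𝕜] Y)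
    (hA : Function.Surjective A) : SeparationQuotient X ≃ₗᵢ[𝕜] Y :=
  LinearIsometryEquiv.ofSurjective
    { toLinearMap := (SeparationQuotient.liftCLM A.toContinuousLinearMap fun _ _ h =>
        (h.map A.continuous).eq).toLinearMap
      norm_map' := SeparationQuotient.surjective_mk.forall.2 fun f =>
        (A.norm_map f).trans (SeparationQuotient.norm_mk f).symm }
    fun y => (hA y).elim fun f hf => ⟨SeparationQuotient.mk f, hf⟩

/-- The isometric isomorphism of separated spaces induced by a surjective linear isometry. -/
noncomputable def separationMapEquiv [SeminormedAddCommGroup Y] [NormedSpace 𝕜 Y] (A : X →ₗᵢ[𝕜] Y)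
    (hA : Function.Surjective A) : SeparationQuotient X ≃ₗᵢ[𝕜] SeparationQuotient Y :=
  let mk : Y →ₗᵢ[𝕜] SeparationQuotient Y :=
    ⟨(SeparationQuotient.mkCLM 𝕜 Y).toLinearMap, SeparationQuotient.norm_mk⟩
  separationLiftEquiv (mk.comp A) (SeparationQuotient.surjective_mk.comp hA)

theorem separationMapEquiv_quotRep {G X Y : Type*} [Group G] [SeminormedAddCommGroup X]
    [InnerProductSpace ℂ X] [SeminormedAddCommGroup Y] [InnerProductSpace ℂ Y]
    {S : G →* Module.End ℂ X} (hS : ∀ s f, ‖S s f‖ = ‖f‖) {T : G →* Module.End ℂ Y}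
    (hT : ∀ s f, ‖T s f‖ = ‖f‖) (A : X →ₗᵢ[ℂ] Y) (hA : Function.Surjective A)
    (hAST : ∀ s f, A (S s f) = T s (A f)) (s : G) (f : SeparationQuotient X) :
    separationMapEquiv A hA (quotRep S hS s f) = quotRep T hT s (separationMapEquiv A hA f) := by
  obtain ⟨f, rfl⟩ := SeparationQuotient.surjective_mk f
  exact congrArg SeparationQuotient.mk (hAST s f)

end SeparatedSpace

namespace UnitarilyEquivalent

variable {G X Y Z : Type*} [Group G] [NormedAddCommGroup X] [InnerProductSpace ℂ X]
  [NormedAddCommGroup Y] [InnerProductSpace ℂ Y] [NormedAddCommGroup Z] [InnerProductSpace ℂ Z]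
  {π₁ : G →* (X ≃ₗᵢ[ℂ] X)} {π₂ : G →* (Y ≃ₗᵢ[ℂ] Y)} {π₃ : G →* (Z ≃ₗᵢ[ℂ] Z)}

theorem symm : UnitarilyEquivalent π₁ π₂ → UnitarilyEquivalent π₂ π₁ := by
  rintro ⟨T, hT⟩
  exact ⟨T.symm, fun s f => by
    rw [LinearIsometryEquiv.symm_apply_eq, hT, LinearIsometryEquiv.apply_symm_apply]⟩

theorem trans : UnitarilyEquivalent π₁ π₂ → UnitarilyEquivalent π₂ π₃ →
    UnitarilyEquivalent π₁ π₃ := by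
  rintro ⟨T, hT⟩ ⟨S, hS⟩
  exact ⟨T.trans S, fun s f => by simp only [LinearIsometryEquiv.trans_apply, hT, hS]⟩

theorem stronglyContinuous [TopologicalSpace G] (h : UnitarilyEquivalent π₁ π₂)
    (hπ₂ : StronglyContinuous π₂) : StronglyContinuous π₁ := by
  obtain ⟨T, hT⟩ := h
  refine fun f => T.isometry.isUniformInducing.isInducing.continuous_iff.2 ?_
  exact (hπ₂ (T f)).congr fun s => (hT s f).symm

theorem completeSpace [CompleteSpace Y] : UnitarilyEquivalent π₁ π₂ → CompleteSpace X :=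
  fun ⟨T, _⟩ => T.toIsometryEquiv.completeSpace

end UnitarilyEquivalent

/-! ### Square-integrable vector-valued functions -/

section Tensor

variable {𝕜 M V : Type*} [RCLike 𝕜] [MeasurableSpace M] (μ : Measure M) [NormedAddCommGroup V]
  [InnerProductSpace 𝕜 V]

variable (𝕜 V) in
/-- The map `L²(μ) ⊗ V → L²(μ; V)`, `f ⊗ v ↦ f(·) v`. -/
noncomputable def lpTensor : Lp 𝕜 2 μ ⊗[𝕜] V →ₗ[𝕜] Lp V 2 μ :=
  TensorProduct.lift <| LinearMap.mk₂ 𝕜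
    (fun f v => (ContinuousLinearMap.toSpanSingleton 𝕜 v).compLp f)
    (fun f g v => ((ContinuousLinearMap.toSpanSingleton 𝕜 v).compLpL 2 μ).map_add f g)
    (fun c f v => ((ContinuousLinearMap.toSpanSingleton 𝕜 v).compLpL 2 μ).map_smul c f)
    (fun f v w => by
      rw [ContinuousLinearMap.toSpanSingleton_add, ContinuousLinearMap.add_compLp])
    (fun c f v => by
      rw [ContinuousLinearMap.toSpanSingleton_smul, ContinuousLinearMap.smul_compLp])

theorem coeFn_lpTensor_tmul (f : Lp 𝕜 2 μ) (v : V) :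
    lpTensor 𝕜 V μ (f ⊗ₜ[𝕜] v) =ᵐ[μ] fun x => f x • v :=
  (ContinuousLinearMap.toSpanSingleton 𝕜 v).coeFn_compLp f

theorem inner_lpTensor (x y : Lp 𝕜 2 μ ⊗[𝕜] V) :
    inner 𝕜 (lpTensor 𝕜 V μ x) (lpTensor 𝕜 V μ y) = inner 𝕜 x y := by
  induction x with
  | zero => simp
  | add x x' hx hx' => rw [map_add, inner_add_left, inner_add_left, hx, hx']
  | tmul f v =>
    induction y with
    | zero => simp
    | add y y' hy hy' => rw [map_add, inner_add_right, inner_add_right, hy, hy']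
    | tmul g w =>
      rw [TensorProduct.inner_tmul, L2.inner_def, L2.inner_def, ← integral_mul_const]
      refine integral_congr_ae ?_
      filter_upwards [coeFn_lpTensor_tmul μ f v, coeFn_lpTensor_tmul μ g w] with x hf hg
      rw [hf, hg, inner_smul_left, inner_smul_right, RCLike.inner_apply]
      ring

theorem lpTensor_surjective [FiniteDimensional 𝕜 V] :
    Function.Surjective (lpTensor 𝕜 V μ) := by
  intro F
  let b := stdOrthonormalBasis 𝕜 V
  let t i : Lp 𝕜 2 μ ⊗[𝕜] V := (innerSL 𝕜 (b i)).compLp F ⊗ₜ[𝕜] b i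
  have ht i : lpTensor 𝕜 V μ (t i) =ᵐ[μ] fun x => inner 𝕜 (b i) (F x) • b i := by
    filter_upwards [coeFn_lpTensor_tmul μ ((innerSL 𝕜 (b i)).compLp F) (b i),
      (innerSL 𝕜 (b i)).coeFn_compLp F] with x hx hx'
    rw [hx, hx', innerSL_apply_apply]
  refine ⟨∑ i, t i, Lp.ext ?_⟩
  rw [map_sum]
  filter_upwards [ae_all_iff.2 ht, Lp.coeFn_fun_finsetSum (p := 2) (μ := μ) Finset.univ
    fun i => lpTensor 𝕜 V μ (t i)] with x hx hsum
  simpa only [hsum, hx] using b.sum_repr' (F x)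

variable (𝕜 V) in
/-- The unitary isomorphism `L²(μ) ⊗ V ≃ L²(μ; V)` for a finite-dimensional Hilbert space `V`. -/
noncomputable def lpTensorEquiv [FiniteDimensional 𝕜 V] :
    (Lp 𝕜 2 μ ⊗[𝕜] V) ≃ₗᵢ[𝕜] Lp V 2 μ :=
  LinearIsometryEquiv.ofSurjective ((lpTensor 𝕜 V μ).isometryOfInner (inner_lpTensor μ))
    (lpTensor_surjective μ)

end Tensor

section LpConvergence

open Filter Topology

theorem memLp_two_iff_lintegral_enorm_sq {M V : Type*} [MeasurableSpace M] [NormedAddCommGroup V]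
    {f : M → V} {μ : Measure M} (hf : AEStronglyMeasurable f μ) :
    MemLp f 2 μ ↔ ∫⁻ x, ‖f x‖ₑ ^ 2 ∂μ < ⊤ := by
  rw [MemLp, and_iff_right hf,
    eLpNorm_lt_top_iff_lintegral_rpow_enorm_lt_top two_ne_zero ENNReal.ofNat_ne_top]
  simp only [ENNReal.toReal_ofNat, ENNReal.rpow_ofNat]

theorem tendsto_eLpNorm_zero_of_dominated {ι M V : Type*} {F : Filter ι} [F.IsCountablyGenerated]
    [MeasurableSpace M] {μ : Measure M} [NormedAddCommGroup V] {p : ENNReal} (hp₀ : p ≠ 0)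
    (hp : p ≠ ⊤) {f : ι → M → V} (g : M → V) (hf : ∀ i, AEStronglyMeasurable (f i) μ)
    (hg : MemLp g p μ) {c : ENNReal} (hc : c ≠ ⊤) (hfg : ∀ i, ∀ᵐ x ∂μ, ‖f i x‖ₑ ≤ c * ‖g x‖ₑ)
    (hlim : ∀ᵐ x ∂μ, Tendsto (fun i => f i x) F (𝓝 0)) :
    Tendsto (fun i => eLpNorm (f i) p μ) F (𝓝 0) := by
  have hr : 0 < p.toReal := ENNReal.toReal_pos hp₀ hp
  have hint : Tendsto (fun i => ∫⁻ x, ‖f i x‖ₑ ^ p.toReal ∂μ) F (𝓝 (∫⁻ _, 0 ∂μ)) := by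
    refine tendsto_lintegral_filter_of_dominated_convergence' (fun x => (c * ‖g x‖ₑ) ^ p.toReal)
      (.of_forall fun i => (hf i).enorm.pow_const _) (.of_forall fun i => ?_) ?_ ?_
    · filter_upwards [hfg i] with x hx using ENNReal.rpow_le_rpow hx hr.le
    · simp_rw [ENNReal.mul_rpow_of_nonneg _ _ hr.le]
      rw [lintegral_const_mul' _ _ (ENNReal.rpow_ne_top_of_nonneg hr.le hc)]
      exact ENNReal.mul_ne_top (ENNReal.rpow_ne_top_of_nonneg hr.le hc)
        (lintegral_rpow_enorm_lt_top_of_eLpNorm_lt_top hp₀ hp hg.2).ne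
    · filter_upwards [hlim] with x hx
      simpa [hr] using hx.enorm.ennrpow_const p.toReal
  simpa [eLpNorm_eq_lintegral_rpow_enorm_toReal hp₀ hp, hr] using
    hint.ennrpow_const (1 / p.toReal)

theorem tendsto_eLpNorm_comp_sub_comp {X M V : Type*} [TopologicalSpace X] [TopologicalSpace M]
    [R1Space M] [MeasurableSpace M] [BorelSpace M] [NormedAddCommGroup V] {p : ENNReal}
    [Fact (1 ≤ p)] (hp : p ≠ ⊤) {μ : Measure M} [IsLocallyFiniteMeasure μ]
    [μ.InnerRegularCompactLTTop] {τ : X → C(M, M)} (hτ : Continuous τ)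
    (hτμ : ∀ s, MeasurePreserving (τ s) μ μ) {f : M → V} (hf : MemLp f p μ) (s₀ : X) :
    Tendsto (fun s => eLpNorm (fun x => f (τ s x) - f (τ s₀ x)) p μ) (𝓝 s₀) (𝓝 0) := by
  have h := (Continuous.compMeasurePreservingLp (f := fun _ : X => hf.toLp f)
    continuous_const hτ hτμ hp).tendsto s₀
  simp_rw [Lp.toLp_compMeasurePreserving] at h
  exact (Lp.tendsto_Lp_iff_tendsto_eLpNorm'' _ _ _ _).1 h

end LpConvergence

/-! ### Hermitian `G`-bundles with constant metric -/

namespace HermitianGBundle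

variable {G M V : Type*} [Group G] [TopologicalSpace M]
  [NormedAddCommGroup V] [InnerProductSpace ℂ V] {l : G →* Equiv.Perm M}

/-- The metric of `B` is the inner product of `V` on every fibre. -/
def HasConstantMetric (B : HermitianGBundle l V) : Prop := ∀ x v w, B.metric x v w = inner ℂ v w

/-- The linear map from the fibre over `l s⁻¹ x` to the fibre over `x` given by the action of `s`,
so that the representation on sections reads `(s f)(x) = transport s x (f (l s⁻¹ x))`. -/
def transport (B : HermitianGBundle l V) (s : G) (x : M) (v : V) : V := (B.act s (l s⁻¹ x, v)).2

theorem transport_sub (B : HermitianGBundle l V) (s : G) (x : M) (v w : V) :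
    B.transport s x (v - w) = B.transport s x v - B.transport s x w := by
  rw [eq_sub_iff_add_eq, transport, transport, ← B.act_add, sub_add_cancel, transport]

theorem HasConstantMetric.norm_transport {B : HermitianGBundle l V} (hB : B.HasConstantMetric)
    (s : G) (x : M) (v : V) : ‖B.transport s x v‖ = ‖v‖ := by
  have h := B.act_isometry s (l s⁻¹ x) v v
  rw [hB, hB] at h
  rw [@norm_eq_sqrt_re_inner ℂ, @norm_eq_sqrt_re_inner ℂ _ _ _ _ v]
  exact congrArg (fun z : ℂ => √(RCLike.re z)) h

theorem HasConstantMetric.ofReal_metric_self {B : HermitianGBundle l V} (hB : B.HasConstantMetric)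
    (x : M) (v : V) : ENNReal.ofReal (B.metric x v v).re = ‖v‖ₑ ^ 2 := by
  rw [hB, ← ofReal_norm, ← ENNReal.ofReal_pow (norm_nonneg _), norm_sq_eq_re_inner (𝕜 := ℂ) v]
  rfl

theorem continuous_transport_apply [TopologicalSpace G] [ContinuousInv G]
    {B : HermitianGBundle l V} (hl : Continuous fun p : G × M => l p.1 p.2)
    (hact : Continuous fun p : G × (M × V) => B.act p.1 p.2) (x : M) (v : V) :
    Continuous fun s => B.transport s x v :=
  continuous_snd.comp <| hact.comp <| continuous_id.prodMk <|
    (hl.comp (continuous_inv.prodMk continuous_const)).prodMk continuous_const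

variable [MeasurableSpace M] [OpensMeasurableSpace M] [FiniteDimensional ℂ V]
  [MeasurableSpace V] [BorelSpace V]

theorem aestronglyMeasurable_transport (B : HermitianGBundle l V) {μ : Measure M}
    (hμ : ∀ s, MeasurePreserving (l s) μ μ) (s : G) {f : M → V} (hf : Measurable f) :
    AEStronglyMeasurable (fun x => B.transport s x (f x)) μ := by
  have : ProperSpace V := FiniteDimensional.proper ℂ V
  have : SecondCountableTopology V := secondCountable_of_proper
  exact ((continuous_snd.comp (B.continuous_act s)).measurable.comp
    ((hμ s⁻¹).measurable.prodMk hf)).aestronglyMeasurable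

theorem preRep_eq_transport (B : HermitianGBundle l V) {μ : Measure M}
    (hμ : ∀ s, MeasurePreserving (l s) μ μ) (s : G) (f : B.L2Pre μ) :
    ⇑(B.preRep hμ s f) = fun x => B.transport s x (f (l s⁻¹ x)) := by
  funext x
  rw [transport, map_inv, ← preRep_apply]

theorem L2Pre.memLp {B : HermitianGBundle l V} (hB : B.HasConstantMetric) {μ : Measure M}
    (f : B.L2Pre μ) : MemLp f 2 μ := by
  have : ProperSpace V := FiniteDimensional.proper ℂ V
  have : SecondCountableTopology V := secondCountable_of_proper
  refine (memLp_two_iff_lintegral_enorm_sq f.measurable.aestronglyMeasurable).2 ?_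
  simpa only [hB.ofReal_metric_self] using f.lintegral_lt_top

namespace HasConstantMetric

variable {B : HermitianGBundle l V} (hB : B.HasConstantMetric) (μ : Measure M)

/-- The isometry from the square-integrable sections of a bundle with constant metric to
`L²(μ; V)`, taking a section to its class. -/
noncomputable def toLpIsometry : B.L2Pre μ →ₗᵢ[ℂ] Lp V 2 μ :=
  LinearMap.isometryOfInner
    { toFun := fun f => (f.memLp hB).toLp f
      map_add' := fun f g => MemLp.toLp_add (f.memLp hB) (g.memLp hB)
      map_smul' := fun c f => MemLp.toLp_const_smul c (f.memLp hB) }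
    fun f g => by
      refine (integral_congr_ae ?_ : _ = ∫ x, B.metric x (f x) (g x) ∂μ)
      filter_upwards [(f.memLp hB).coeFn_toLp, (g.memLp hB).coeFn_toLp] with x hf hg
      rw [hB, ← hf, ← hg]
      rfl

theorem toLpIsometry_surjective : Function.Surjective (hB.toLpIsometry μ) := by
  have : ProperSpace V := FiniteDimensional.proper ℂ V
  have : SecondCountableTopology V := secondCountable_of_proper
  intro F
  have hF : Measurable F := (Lp.stronglyMeasurable F).measurable
  have hF_sq := (memLp_two_iff_lintegral_enorm_sq hF.aestronglyMeasurable).1 (Lp.memLp F)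
  exact ⟨L2Pre.mk F hF (by simpa only [hB.ofReal_metric_self] using hF_sq),
    Lp.toLp_coeFn F (Lp.memLp F)⟩

/-- The identification of the `L²`-section space of a bundle with constant metric with
`L²(μ; V)`. -/
noncomputable def l2SectionEquiv : B.L2Section μ ≃ₗᵢ[ℂ] Lp V 2 μ :=
  separationLiftEquiv (X := B.L2Pre μ) (hB.toLpIsometry μ) (hB.toLpIsometry_surjective μ)

include hB in
theorem completeSpace_l2Section : CompleteSpace (B.L2Section μ) :=
  (hB.l2SectionEquiv μ).toIsometryEquiv.completeSpace

include hB in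
theorem exists_tensorEquiv :
    ∃ S : (Lp ℂ 2 μ ⊗[ℂ] V) ≃ₗᵢ[ℂ] B.L2Section μ,
      ∀ (f : Lp ℂ 2 μ) (v : V), ∃ ψ : B.L2Pre μ,
        (∀ᵐ x ∂μ, ψ x = f x • v) ∧ S (f ⊗ₜ[ℂ] v) = B.toL2 μ ψ := by
  refine ⟨(lpTensorEquiv ℂ V μ).trans (hB.l2SectionEquiv μ).symm, fun f v => ?_⟩
  obtain ⟨ψ, hψ⟩ := hB.toLpIsometry_surjective μ (lpTensor ℂ V μ (f ⊗ₜ[ℂ] v))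
  have hψ_ae : ψ =ᵐ[μ] lpTensor ℂ V μ (f ⊗ₜ[ℂ] v) := hψ ▸ (ψ.memLp hB).coeFn_toLp.symm
  exact ⟨ψ, hψ_ae.trans (coeFn_lpTensor_tmul μ f v),
    (LinearIsometryEquiv.symm_apply_eq _).2 hψ.symm⟩

variable {μ}

include hB in
theorem eLpNorm_preRep_sub_le (hμ : ∀ s, MeasurePreserving (l s) μ μ) (f : B.L2Pre μ) (s t : G) :
    eLpNorm (⇑(B.preRep hμ s f) - ⇑(B.preRep hμ t f)) 2 μ
      ≤ eLpNorm (fun x => f (l s⁻¹ x) - f (l t⁻¹ x)) 2 μ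
        + eLpNorm (fun x => B.transport s x (f (l t⁻¹ x)) - B.transport t x (f (l t⁻¹ x))) 2 μ := by
  have : ProperSpace V := FiniteDimensional.proper ℂ V
  have : SecondCountableTopology V := secondCountable_of_proper
  have hf (s : G) : Measurable fun x => f (l s⁻¹ x) := f.measurable.comp (hμ s⁻¹).measurable
  have hsplit : ⇑(B.preRep hμ s f) - ⇑(B.preRep hμ t f)
      = (fun x => B.transport s x (f (l s⁻¹ x) - f (l t⁻¹ x)))
        + fun x => B.transport s x (f (l t⁻¹ x)) - B.transport t x (f (l t⁻¹ x)) := by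
    funext x
    simp only [preRep_eq_transport, Pi.sub_apply, Pi.add_apply, transport_sub]
    abel
  have hnorm : eLpNorm (fun x => B.transport s x (f (l s⁻¹ x) - f (l t⁻¹ x))) 2 μ
      = eLpNorm (fun x => f (l s⁻¹ x) - f (l t⁻¹ x)) 2 μ :=
    eLpNorm_congr_norm_ae (.of_forall fun x => hB.norm_transport s x _)
  rw [hsplit, ← hnorm]
  exact eLpNorm_add_le (B.aestronglyMeasurable_transport hμ s ((hf s).sub (hf t)))
    ((B.aestronglyMeasurable_transport hμ s (hf t)).sub
      (B.aestronglyMeasurable_transport hμ t (hf t))) one_le_two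

variable [TopologicalSpace G] [ContinuousInv G]

open Filter Topology

include hB in
theorem tendsto_eLpNorm_transport_sub [FirstCountableTopology G]
    (hμ : ∀ s, MeasurePreserving (l s) μ μ) (hl : Continuous fun p : G × M => l p.1 p.2)
    (hact : Continuous fun p : G × (M × V) => B.act p.1 p.2) {f : M → V} (hf : Measurable f)
    (hf_memLp : MemLp f 2 μ) (t : G) :
    Tendsto (fun s => eLpNorm (fun x => B.transport s x (f x) - B.transport t x (f x)) 2 μ)
      (𝓝 t) (𝓝 0) := by
  refine tendsto_eLpNorm_zero_of_dominated two_ne_zero ENNReal.ofNat_ne_top f (fun s =>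
    (B.aestronglyMeasurable_transport hμ s hf).sub (B.aestronglyMeasurable_transport hμ t hf))
    hf_memLp (c := 2) ENNReal.ofNat_ne_top (fun s => .of_forall fun x => ?_)
    (.of_forall fun x => ?_)
  · refine enorm_sub_le.trans_eq ?_
    rw [← ofReal_norm, ← ofReal_norm (B.transport t x _), hB.norm_transport, hB.norm_transport,
      ofReal_norm, two_mul]
  · exact tendsto_sub_nhds_zero_iff.2 ((continuous_transport_apply hl hact x (f x)).tendsto t)

include hB in
theorem stronglyContinuous_rep [FirstCountableTopology G] [R1Space M] [BorelSpace M]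
    [IsLocallyFiniteMeasure μ] [μ.InnerRegularCompactLTTop]
    (hμ : ∀ s, MeasurePreserving (l s) μ μ) (hl : Continuous fun p : G × M => l p.1 p.2)
    (hact : Continuous fun p : G × (M × V) => B.act p.1 p.2) :
    StronglyContinuous (B.rep hμ) := by
  refine SeparationQuotient.surjective_mk.forall.2 fun f => ?_
  refine (hB.l2SectionEquiv μ).isometry.isUniformInducing.isInducing.continuous_iff.2 ?_
  refine continuous_iff_continuousAt.2 fun t => ?_
  refine (Lp.tendsto_Lp_iff_tendsto_eLpNorm'' _ (fun s => (B.preRep hμ s f).memLp hB) _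
    ((B.preRep hμ t f).memLp hB)).2 ?_
  let τ : G → C(M, M) := fun s => ⟨l s⁻¹, hl.comp (.prodMk_right s⁻¹)⟩
  have hτ : Continuous τ := ContinuousMap.continuous_of_continuous_uncurry _
    (hl.comp (continuous_fst.inv.prodMk continuous_snd))
  have hbase : Tendsto (fun s => eLpNorm (fun x => f (l s⁻¹ x) - f (l t⁻¹ x)) 2 μ) (𝓝 t) (𝓝 0) :=
    tendsto_eLpNorm_comp_sub_comp ENNReal.ofNat_ne_top hτ (fun s => hμ s⁻¹) (f.memLp hB) t
  have hfibre := hB.tendsto_eLpNorm_transport_sub hμ hl hact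
    (f.measurable.comp (hμ t⁻¹).measurable) ((f.memLp hB).comp_measurePreserving (hμ t⁻¹)) t
  exact tendsto_of_tendsto_of_tendsto_of_le_of_le tendsto_const_nhds
    (by simpa only [add_zero] using! hbase.add hfibre) (fun _ => zero_le)
    fun s => hB.eLpNorm_preRep_sub_le hμ f s t

end HasConstantMetric

end HermitianGBundle

/-! ### Isomorphisms of Hermitian `G`-bundles -/

namespace HermitianGBundle

variable {G M V : Type*} [Group G] [TopologicalSpace M]
  [NormedAddCommGroup V] [InnerProductSpace ℂ V] {l : G →* Equiv.Perm M}
  {B B' : HermitianGBundle l V} {α : M × V → M × V}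
  {EM : Type*} [NormedAddCommGroup EM] [NormedSpace ℝ EM] [ChartedSpace EM M]

theorem IsIso.continuous (h : B.IsIso B' α (EM := EM)) : Continuous α := by
  obtain ⟨e, rfl⟩ := h.diffeo
  exact e.continuous

theorem IsIso.symm
    {e : Diffeomorph (𝓘(ℝ, EM).prod 𝓘(ℝ, V)) (𝓘(ℝ, EM).prod 𝓘(ℝ, V)) (M × V) (M × V) ∞}
    (h : B.IsIso B' e (EM := EM)) : B'.IsIso B e.symm (EM := EM) := by
  have fst_symm (p : M × V) : (e.symm p).1 = p.1 := by
    rw [← h.fst, e.apply_symm_apply]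
  have apply_symm (x : M) (v : V) : e (x, (e.symm (x, v)).2) = (x, v) := by
    have : (x, (e.symm (x, v)).2) = e.symm (x, v) := Prod.ext (fst_symm (x, v)).symm rfl
    rw [this, e.apply_symm_apply]
  have snd_symm {x : M} {v w : V} (hvw : (e (x, w)).2 = v) : (e.symm (x, v)).2 = w := by
    have : (x, v) = e (x, w) := Prod.ext (h.fst (x, w)).symm hvw.symm
    rw [this, e.symm_apply_apply]
  exact
    { diffeo := ⟨e.symm, rfl⟩
      fst := fst_symm
      map_add := fun x v w => snd_symm (by rw [h.map_add, apply_symm, apply_symm])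
      map_smul := fun x c v => snd_symm (by rw [h.map_smul, apply_symm])
      isometry := fun x v w => by rw [← h.isometry, apply_symm, apply_symm]
      equivariant := fun s p => by
        rw [← e.symm_apply_apply (B.act s (e.symm p)), h.equivariant, e.apply_symm_apply] }

theorem IsIso.isSmooth {EG : Type*} [NormedAddCommGroup EG] [NormedSpace ℝ EG]
    [TopologicalSpace G] [ChartedSpace EG G] (h : B.IsIso B' α (EM := EM))
    (hB : B.IsSmooth (EG := EG) (EM := EM)) : B'.IsSmooth (EG := EG) (EM := EM) := by
  obtain ⟨e, rfl⟩ := h.diffeo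
  refine ⟨hB.base, ?_, ?_⟩
  · have hsymm {f : M × V × V → M × V}
        (hf : ContMDiff (𝓘(ℝ, EM).prod (𝓘(ℝ, V).prod 𝓘(ℝ, V))) (𝓘(ℝ, EM).prod 𝓘(ℝ, V)) ∞ f) :
        ContMDiff (𝓘(ℝ, EM).prod (𝓘(ℝ, V).prod 𝓘(ℝ, V))) 𝓘(ℝ, V) ∞ fun p => (e.symm (f p)).2 :=
      contMDiff_snd.comp (e.symm.contMDiff.comp hf)
    refine (hB.metric.comp (contMDiff_fst.prodMk
      ((hsymm (contMDiff_fst.prodMk (contMDiff_fst.comp contMDiff_snd))).prodMk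
        (hsymm (contMDiff_fst.prodMk (contMDiff_snd.comp contMDiff_snd)))))).congr fun p => ?_
    exact (h.symm.isometry p.1 p.2.1 p.2.2).symm
  · refine (e.contMDiff.comp (hB.act.comp (contMDiff_fst.prodMk
      (e.symm.contMDiff.comp contMDiff_snd)))).congr fun p => ?_
    simp only [Function.comp_apply, h.equivariant, e.apply_symm_apply]

variable [MeasurableSpace M] [OpensMeasurableSpace M] [FiniteDimensional ℂ V]
  [MeasurableSpace V] [BorelSpace V]

namespace IsIso

/-- Composition of square-integrable sections with an isomorphism of Hermitian `G`-bundles, as a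
linear isometry. -/
noncomputable def mapL2Pre (h : B.IsIso B' α (EM := EM)) (μ : Measure M) :
    B.L2Pre μ →ₗᵢ[ℂ] B'.L2Pre μ where
  toFun φ := L2Pre.mk (fun x => (α (x, φ x)).2)
    (by
      have : ProperSpace V := FiniteDimensional.proper ℂ V
      have : SecondCountableTopology V := secondCountable_of_proper
      exact (continuous_snd.comp h.continuous).measurable.comp
        (measurable_id.prodMk φ.measurable))
    (by simpa only [h.isometry] using φ.lintegral_lt_top)
  map_add' φ ψ := L2Pre.ext fun x => h.map_add x (φ x) (ψ x)
  map_smul' c φ := L2Pre.ext fun x => h.map_smul x c (φ x)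
  norm_map' φ := congrArg (fun F : M → ℂ => √(RCLike.re (∫ x, F x ∂μ)))
    (funext fun x => h.isometry x (φ x) (φ x))

theorem mk_mapL2Pre (h : B.IsIso B' α (EM := EM)) (μ : Measure M) (φ : B.L2Pre μ) (x : M) :
    (x, h.mapL2Pre μ φ x) = α (x, φ x) :=
  Prod.ext (h.fst (x, φ x)).symm rfl

theorem mapL2Pre_surjective (h : B.IsIso B' α (EM := EM)) (μ : Measure M) :
    Function.Surjective (h.mapL2Pre μ) := by
  obtain ⟨e, rfl⟩ := h.diffeo
  refine fun ψ => ⟨h.symm.mapL2Pre μ ψ, L2Pre.ext fun x => ?_⟩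
  have : (x, h.mapL2Pre μ (h.symm.mapL2Pre μ ψ) x) = (x, ψ x) := by
    rw [mk_mapL2Pre, mk_mapL2Pre, e.apply_symm_apply]
  exact (Prod.ext_iff.1 this).2

theorem mapL2Pre_preRep (h : B.IsIso B' α (EM := EM)) {μ : Measure M}
    (hμ : ∀ s, MeasurePreserving (l s) μ μ) (s : G) (φ : B.L2Pre μ) :
    h.mapL2Pre μ (B.preRep hμ s φ) = B'.preRep hμ s (h.mapL2Pre μ φ) := by
  refine L2Pre.ext fun x => ?_
  have : (x, h.mapL2Pre μ (B.preRep hμ s φ) x) = (x, B'.preRep hμ s (h.mapL2Pre μ φ) x) := by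
    rw [mk_mapL2Pre, preRep_apply, preRep_apply, mk_mapL2Pre, h.equivariant]
  exact (Prod.ext_iff.1 this).2

theorem exists_unitaryEquiv (h : B.IsIso B' α (EM := EM)) {μ : Measure M}
    (hμ : ∀ s, MeasurePreserving (l s) μ μ) :
    ∃ T : B.L2Section μ ≃ₗᵢ[ℂ] B'.L2Section μ,
      (∀ φ : B.L2Pre μ, ∃ ψ : B'.L2Pre μ,
        (∀ x, (x, ψ x) = α (x, φ x)) ∧ T (B.toL2 μ φ) = B'.toL2 μ ψ) ∧
      ∀ s f, T (B.rep hμ s f) = B'.rep hμ s (T f) :=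
  ⟨separationMapEquiv (h.mapL2Pre μ) (h.mapL2Pre_surjective μ),
    fun φ => ⟨h.mapL2Pre μ φ, h.mk_mapL2Pre μ φ, rfl⟩,
    separationMapEquiv_quotRep (B.norm_preRep hμ) (B'.norm_preRep hμ) (h.mapL2Pre μ)
      (h.mapL2Pre_surjective μ) (h.mapL2Pre_preRep hμ)⟩

end IsIso

end HermitianGBundle

/-! ### Smoothness of the perception and boosting bundles -/

theorem contMDiff_complex_clm_apply {V W E' H' M' : Type*}
    [NormedAddCommGroup V] [NormedSpace ℂ V] [NormedAddCommGroup W] [NormedSpace ℂ W]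
    [NormedAddCommGroup E'] [NormedSpace ℝ E'] [TopologicalSpace H'] {J : ModelWithCorners ℝ E' H'}
    [TopologicalSpace M'] [ChartedSpace H' M'] {n : ℕ∞ω} {A : M' → V →L[ℂ] W} {f : M' → V}
    (hA : ContMDiff J 𝓘(ℝ, V →L[ℂ] W) n A) (hf : ContMDiff J 𝓘(ℝ, V) n f) :
    ContMDiff J 𝓘(ℝ, W) n fun x => A x (f x) := by
  have happly : ContDiff ℝ n fun p : (V →L[ℂ] W) × V => p.1 p.2 :=
    (isBoundedBilinearMap_apply (𝕜 := ℂ) (E := V) (F := W)).contDiff.restrict_scalars ℝ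
  exact happly.comp_contMDiff (hA.prodMk_space hf)

theorem contMDiff_circle_coe {n : ℕ∞ω} : ContMDiff (𝓡 1) 𝓘(ℝ, ℂ) n fun z : Circle => (z : ℂ) :=
  have : Fact (Module.finrank ℝ ℂ = 1 + 1) := finrank_real_complex_fact'
  contMDiff_coe_sphere (E := ℂ)

theorem units_map_mul_apply {K 𝕜 V : Type*} [Monoid K] [Semiring 𝕜] [AddCommMonoid V] [Module 𝕜 V]
    [TopologicalSpace V] (Φ : K →* (V →L[𝕜] V)ˣ) (x y : K) (v : V) :
    (Φ (x * y) : V →L[𝕜] V) v = (Φ x : V →L[𝕜] V) ((Φ y : V →L[𝕜] V) v) := by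
  rw [map_mul, Units.val_mul, mul_apply_eq_comp]

theorem contMDiff_quotient_smul {EK EM E' K H' M' : Type*}
    [NormedAddCommGroup EK] [NormedSpace ℝ EK] [NormedAddCommGroup EM] [NormedSpace ℝ EM]
    [NormedAddCommGroup E'] [NormedSpace ℝ E'] [Group K] [TopologicalSpace K] [ChartedSpace EK K]
    {n : ℕ∞ω} [ContMDiffMul 𝓘(ℝ, EK) n K] {Γ : Subgroup K} [ChartedSpace EM (K ⧸ Γ)]
    [TopologicalSpace H'] {J : ModelWithCorners ℝ E' H'} [TopologicalSpace M'] [ChartedSpace H' M']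
    (hπ : ContMDiff 𝓘(ℝ, EK) 𝓘(ℝ, EM) n (QuotientGroup.mk : K → K ⧸ Γ))
    {S : K ⧸ Γ → K} (hS_smooth : ContMDiff 𝓘(ℝ, EM) 𝓘(ℝ, EK) n S)
    (hS : ∀ q, (S q : K ⧸ Γ) = q) {f : M' → K} {g : M' → K ⧸ Γ}
    (hf : ContMDiff J 𝓘(ℝ, EK) n f) (hg : ContMDiff J 𝓘(ℝ, EM) n g) :
    ContMDiff J 𝓘(ℝ, EM) n fun x => f x • g x :=
  (hπ.comp (hf.mul (hS_smooth.comp hg))).congr fun x => congrArg (f x • ·) (hS (g x)).symm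

section Smooth

variable {EG EN EH EM : Type*}
  [NormedAddCommGroup EG] [NormedSpace ℝ EG] [NormedAddCommGroup EN] [NormedSpace ℝ EN]
  [NormedAddCommGroup EH] [NormedSpace ℝ EH] [NormedAddCommGroup EM] [NormedSpace ℝ EM]
  {G : Type*} [Group G] [TopologicalSpace G] [ChartedSpace EG G]
  {N H : Subgroup G} [ChartedSpace EN N] [ChartedSpace EH H]
  {E' H' M' : Type*} [NormedAddCommGroup E'] [NormedSpace ℝ E'] [TopologicalSpace H']
  {J : ModelWithCorners ℝ E' H'} [TopologicalSpace M'] [ChartedSpace H' M']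

/-- Multiplication `(n, h) ↦ n h` is a diffeomorphism of `N × H` onto `G`. This is the geometric
part of `IsLieSemidirect`; it leaves open whether `N` is abelian. -/
def IsSmoothSemidirect {EG EN EH : Type*} [NormedAddCommGroup EG] [NormedSpace ℝ EG]
    [NormedAddCommGroup EN] [NormedSpace ℝ EN] [NormedAddCommGroup EH] [NormedSpace ℝ EH]
    {G : Type*} [Group G] [TopologicalSpace G] [ChartedSpace EG G] (N H : Subgroup G)
    [ChartedSpace EN N] [ChartedSpace EH H] : Prop :=
  ∃ e : Diffeomorph (𝓘(ℝ, EN).prod 𝓘(ℝ, EH)) 𝓘(ℝ, EG) (N × H) G ∞, ⇑e = mulMap N H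

namespace IsSmoothSemidirect

theorem bijective (hG : IsSmoothSemidirect (EG := EG) (EN := EN) (EH := EH) N H) :
    Function.Bijective (mulMap N H) := by
  obtain ⟨e, he⟩ := hG
  exact he ▸ e.bijective

theorem contMDiff_mulMap (hG : IsSmoothSemidirect (EG := EG) (EN := EN) (EH := EH) N H) :
    ContMDiff (𝓘(ℝ, EN).prod 𝓘(ℝ, EH)) 𝓘(ℝ, EG) ∞ (mulMap N H) := by
  obtain ⟨e, he⟩ := hG
  exact he ▸ e.contMDiff

theorem contMDiff_coe_left (hG : IsSmoothSemidirect (EG := EG) (EN := EN) (EH := EH) N H) :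
    ContMDiff 𝓘(ℝ, EN) 𝓘(ℝ, EG) ∞ ((↑) : N → G) :=
  (hG.contMDiff_mulMap.comp (contMDiff_id.prodMk (contMDiff_const (c := (1 : H))))).congr
    fun n => (mul_one (n : G)).symm

theorem contMDiff_coe_right (hG : IsSmoothSemidirect (EG := EG) (EN := EN) (EH := EH) N H) :
    ContMDiff 𝓘(ℝ, EH) 𝓘(ℝ, EG) ∞ ((↑) : H → G) :=
  (hG.contMDiff_mulMap.comp ((contMDiff_const (c := (1 : N))).prodMk contMDiff_id)).congr
    fun h => (one_mul (h : G)).symm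

theorem contMDiff_parts (hG : IsSmoothSemidirect (EG := EG) (EN := EN) (EH := EH) N H) :
    ContMDiff 𝓘(ℝ, EG) (𝓘(ℝ, EN).prod 𝓘(ℝ, EH)) ∞
      fun g => (nPart hG.bijective g, hPart hG.bijective g) := by
  have hbij := hG.bijective
  obtain ⟨e, he⟩ := hG
  refine e.symm.contMDiff.congr fun g => (Equiv.ofBijective _ hbij).symm_apply_eq.2 ?_
  rw [Equiv.ofBijective_apply, ← he, e.apply_symm_apply]

theorem contMDiff_nPart (hG : IsSmoothSemidirect (EG := EG) (EN := EN) (EH := EH) N H) :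
    ContMDiff 𝓘(ℝ, EG) 𝓘(ℝ, EN) ∞ (nPart hG.bijective) :=
  contMDiff_fst.comp hG.contMDiff_parts

theorem contMDiff_hPart (hG : IsSmoothSemidirect (EG := EG) (EN := EN) (EH := EH) N H) :
    ContMDiff 𝓘(ℝ, EG) 𝓘(ℝ, EH) ∞ (hPart hG.bijective) :=
  contMDiff_snd.comp hG.contMDiff_parts

variable [N.Normal]

theorem contMDiff_conjNormal [LieGroup 𝓘(ℝ, EG) ∞ G]
    (hG : IsSmoothSemidirect (EG := EG) (EN := EN) (EH := EH) N H) {f : M' → H} {g : M' → N}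
    (hf : ContMDiff J 𝓘(ℝ, EH) ∞ f) (hg : ContMDiff J 𝓘(ℝ, EN) ∞ g) :
    ContMDiff J 𝓘(ℝ, EN) ∞ fun x => MulAut.conjNormal (f x : G)⁻¹ (g x) := by
  have hf_coe := hG.contMDiff_coe_right.comp hf
  have hg_coe := hG.contMDiff_coe_left.comp hg
  refine (hG.contMDiff_nPart.comp ((hf_coe.inv.mul hg_coe).mul hf_coe)).congr fun x => ?_
  refine (parts_eq (h := 1) hG.bijective ?_).1.symm
  simp

variable {ν : N →* Circle} [ChartedSpace EM (H ⧸ littleGroup H ν)] {L : H ⧸ littleGroup H ν → H}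

theorem contMDiff_charTwist [LieGroup 𝓘(ℝ, EG) ∞ G]
    (hG : IsSmoothSemidirect (EG := EG) (EN := EN) (EH := EH) N H)
    (hν : ContMDiff 𝓘(ℝ, EN) (𝓡 1) ∞ ν) (hLs : ContMDiff 𝓘(ℝ, EM) 𝓘(ℝ, EH) ∞ L)
    (hL : ∀ q, (L q : H ⧸ littleGroup H ν) = q) {f : M' → N} {g : M' → H ⧸ littleGroup H ν}
    (hf : ContMDiff J 𝓘(ℝ, EN) ∞ f) (hg : ContMDiff J 𝓘(ℝ, EM) ∞ g) :
    ContMDiff J 𝓘(ℝ, ℂ) ∞ fun x => (charTwist ν (f x) (g x) : ℂ) :=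
  (contMDiff_circle_coe.comp (hν.comp (hG.contMDiff_conjNormal (hLs.comp hg) hf))).congr
    fun x => congrArg (fun q => (charTwist ν (f x) q : ℂ)) (hL (g x)).symm

theorem contMDiff_baseAction [ContMDiffMul 𝓘(ℝ, EH) ∞ H]
    (hG : IsSmoothSemidirect (EG := EG) (EN := EN) (EH := EH) N H)
    (hπ : ContMDiff 𝓘(ℝ, EH) 𝓘(ℝ, EM) ∞ (QuotientGroup.mk : H → H ⧸ littleGroup H ν))
    (hLs : ContMDiff 𝓘(ℝ, EM) 𝓘(ℝ, EH) ∞ L) (hL : ∀ q, (L q : H ⧸ littleGroup H ν) = q) :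
    ContMDiff (𝓘(ℝ, EG).prod 𝓘(ℝ, EM)) 𝓘(ℝ, EM) ∞
      fun p : G × (H ⧸ littleGroup H ν) => baseAction hG.bijective ν p.1 p.2 :=
  contMDiff_quotient_smul hπ hLs hL (hG.contMDiff_hPart.comp contMDiff_fst) contMDiff_snd

end IsSmoothSemidirect

variable [N.Normal] {ν : N →* Circle} {L : H ⧸ littleGroup H ν → H}
  {V : Type*} [NormedAddCommGroup V] [InnerProductSpace ℂ V] [CompleteSpace V]
  {σ : littleGroup H ν →* unitary (V →L[ℂ] V)} {Φ : H →* (V →L[ℂ] V)ˣ}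

omit [TopologicalSpace G] in
theorem formOf_perceptionOp (hΦσ : ∀ k : littleGroup H ν, (Φ k : V →L[ℂ] V) = σ k)
    (hL : ∀ q, (L q : H ⧸ littleGroup H ν) = q) (q : H ⧸ littleGroup H ν) (v w : V) :
    formOf (perceptionOp hΦσ q) v w
      = inner ℂ ((Φ (L q)⁻¹ : V →L[ℂ] V) v) ((Φ (L q)⁻¹ : V →L[ℂ] V) w) := by
  rw [← formOf_perceptionOp_mk hΦσ, hL]

variable [ChartedSpace EM (H ⧸ littleGroup H ν)] [LieGroup 𝓘(ℝ, EH) ∞ H]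

/-- The map `boostMap Φ L` as a diffeomorphism of the total spaces. -/
noncomputable def boostDiffeomorph
    (hΦ : ContMDiff 𝓘(ℝ, EH) 𝓘(ℝ, V →L[ℂ] V) ∞ fun x => (Φ x : V →L[ℂ] V))
    (hLs : ContMDiff 𝓘(ℝ, EM) 𝓘(ℝ, EH) ∞ L) :
    Diffeomorph (𝓘(ℝ, EM).prod 𝓘(ℝ, V)) (𝓘(ℝ, EM).prod 𝓘(ℝ, V))
      ((H ⧸ littleGroup H ν) × V) ((H ⧸ littleGroup H ν) × V) ∞ where
  toFun := boostMap Φ L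
  invFun p := (p.1, (Φ (L p.1) : V →L[ℂ] V) p.2)
  left_inv p := Prod.ext rfl <| show (Φ (L p.1) : V →L[ℂ] V) ((Φ (L p.1)⁻¹ : V →L[ℂ] V) p.2) = p.2
    by rw [← units_map_mul_apply, mul_inv_cancel, map_one, Units.val_one, one_apply_eq_self]
  right_inv p := Prod.ext rfl <| show (Φ (L p.1)⁻¹ : V →L[ℂ] V) ((Φ (L p.1) : V →L[ℂ] V) p.2) = p.2
    by rw [← units_map_mul_apply, inv_mul_cancel, map_one, Units.val_one, one_apply_eq_self]
  contMDiff_toFun := contMDiff_fst.prodMk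
    (contMDiff_complex_clm_apply (hΦ.comp (hLs.comp contMDiff_fst).inv) contMDiff_snd)
  contMDiff_invFun := contMDiff_fst.prodMk
    (contMDiff_complex_clm_apply (hΦ.comp (hLs.comp contMDiff_fst)) contMDiff_snd)

variable [IsTopologicalGroup G]

theorem isIso_boostMap (hNH : Function.Bijective (mulMap N H)) (hν : Continuous ν)
    (hσ : Continuous fun k => (σ k : V →L[ℂ] V))
    (hΦ : ContMDiff 𝓘(ℝ, EH) 𝓘(ℝ, V →L[ℂ] V) ∞ fun x => (Φ x : V →L[ℂ] V))
    (hΦσ : ∀ k : littleGroup H ν, (Φ k : V →L[ℂ] V) = σ k)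
    (hLs : ContMDiff 𝓘(ℝ, EM) 𝓘(ℝ, EH) ∞ L) (hL : ∀ q, (L q : H ⧸ littleGroup H ν) = q) :
    (perceptionBundle hNH hν hΦ.continuous hΦσ).IsIso
      (boostingBundle hNH hν hσ hLs.continuous hL) (boostMap Φ L) (EM := EM) where
  diffeo := ⟨boostDiffeomorph hΦ hLs, rfl⟩
  fst _ := rfl
  map_add x v w := map_add (Φ (L x)⁻¹ : V →L[ℂ] V) v w
  map_smul x c v := map_smul (Φ (L x)⁻¹ : V →L[ℂ] V) c v
  isometry x v w := (formOf_perceptionOp hΦσ hL x v w).symm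
  equivariant s p := by
    refine Prod.ext rfl ?_
    change (Φ (L (hPart hNH s • p.1))⁻¹ : V →L[ℂ] V)
        ((_ : ℂ) • (Φ (hPart hNH s) : V →L[ℂ] V) p.2)
      = (_ : ℂ) • (σ (wigner hL (hPart hNH s) p.1) : V →L[ℂ] V)
        ((Φ (L p.1)⁻¹ : V →L[ℂ] V) p.2)
    have hwigner : (L (hPart hNH s • p.1))⁻¹ * hPart hNH s
        = wigner hL (hPart hNH s) p.1 * (L p.1)⁻¹ := (mul_inv_cancel_right _ _).symm
    rw [map_smul, ← units_map_mul_apply, hwigner, units_map_mul_apply, hΦσ]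
    rfl

theorem isSmooth_perceptionBundle [LieGroup 𝓘(ℝ, EG) ∞ G]
    (hG : IsSmoothSemidirect (EG := EG) (EN := EN) (EH := EH) N H)
    (hν : ContMDiff 𝓘(ℝ, EN) (𝓡 1) ∞ ν)
    (hΦ : ContMDiff 𝓘(ℝ, EH) 𝓘(ℝ, V →L[ℂ] V) ∞ fun x => (Φ x : V →L[ℂ] V))
    (hΦσ : ∀ k : littleGroup H ν, (Φ k : V →L[ℂ] V) = σ k)
    (hπ : ContMDiff 𝓘(ℝ, EH) 𝓘(ℝ, EM) ∞ (QuotientGroup.mk : H → H ⧸ littleGroup H ν))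
    (hLs : ContMDiff 𝓘(ℝ, EM) 𝓘(ℝ, EH) ∞ L) (hL : ∀ q, (L q : H ⧸ littleGroup H ν) = q) :
    (perceptionBundle hG.bijective hν.continuous hΦ.continuous hΦσ).IsSmooth
      (EG := EG) (EM := EM) where
  base := hG.contMDiff_baseAction hπ hLs hL
  metric := by
    have hboost : ContMDiff (𝓘(ℝ, EM).prod (𝓘(ℝ, V).prod 𝓘(ℝ, V))) 𝓘(ℝ, V →L[ℂ] V) ∞
        fun p : (H ⧸ littleGroup H ν) × V × V => (Φ (L p.1)⁻¹ : V →L[ℂ] V) :=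
      hΦ.comp (hLs.comp contMDiff_fst).inv
    have hv := contMDiff_complex_clm_apply hboost (contMDiff_fst.comp contMDiff_snd)
    have hw := contMDiff_complex_clm_apply hboost (contMDiff_snd.comp contMDiff_snd)
    exact ((contDiff_inner (𝕜 := ℂ) (E := V)).comp_contMDiff (hv.prodMk_space hw)).congr
      fun p => formOf_perceptionOp hΦσ hL p.1 p.2.1 p.2.2
  act := by
    have hh := hG.contMDiff_hPart.comp (contMDiff_fst (I := 𝓘(ℝ, EG))
      (J := 𝓘(ℝ, EM).prod 𝓘(ℝ, V)) (M := G) (N := (H ⧸ littleGroup H ν) × V))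
    have hbase := contMDiff_quotient_smul hπ hLs hL hh (contMDiff_fst.comp contMDiff_snd)
    have htwist := hG.contMDiff_charTwist hν hLs hL (hG.contMDiff_nPart.comp contMDiff_fst) hbase
    have hΦ_apply := contMDiff_complex_clm_apply (hΦ.comp hh) (contMDiff_snd.comp contMDiff_snd)
    exact hbase.prodMk (contDiff_smul.comp_contMDiff (htwist.prodMk_space hΦ_apply))

omit [ChartedSpace EN N] [ChartedSpace EG G] in
theorem hasConstantMetric_boostingBundle (hNH : Function.Bijective (mulMap N H))
    (hν : Continuous ν) (hσ : Continuous fun k => (σ k : V →L[ℂ] V)) (hLc : Continuous L)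
    (hL : ∀ q, (L q : H ⧸ littleGroup H ν) = q) :
    (boostingBundle hNH hν hσ hLc hL).HasConstantMetric :=
  fun _ _ _ => rfl

end Smooth

/-! ### Induced representations along a global section -/

section InducedRepresentation

variable {G : Type*} [Group G] {K : Subgroup G} {M : Type*} {c : M ≃ G ⧸ K} {S : M → G}
  {V : Type*} [NormedAddCommGroup V] [InnerProductSpace ℂ V] [CompleteSpace V]
  {τ : K →* unitary (V →L[ℂ] V)}

/-- The factor `k ∈ K` in the decomposition `g = S(gK) k` given by a section `S` of `G → G/K`, the
coset space being parametrised by `c : M ≃ G/K`. -/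
def cosetPart (hS : ∀ q, (S q : G ⧸ K) = c q) (g : G) : K :=
  ⟨(S (c.symm g))⁻¹ * g, QuotientGroup.eq.1 <| by rw [hS, c.apply_symm_apply]⟩

theorem section_mul_cosetPart (hS : ∀ q, (S q : G ⧸ K) = c q) (g : G) :
    S (c.symm g) * cosetPart hS g = g :=
  mul_inv_cancel_left _ _

theorem cosetPart_mul (hS : ∀ q, (S q : G ⧸ K) = c q) (g : G) (k : K) :
    cosetPart hS (g * k) = cosetPart hS g * k := by
  refine Subtype.ext ?_
  change (S (c.symm ((g * k : G) : G ⧸ K)))⁻¹ * (g * k) = (S (c.symm g))⁻¹ * g * k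
  rw [QuotientGroup.mk_mul_of_mem g k.2, mul_assoc]

theorem cosetPart_section (hS : ∀ q, (S q : G ⧸ K) = c q) (q : M) : cosetPart hS (S q) = 1 := by
  refine Subtype.ext ?_
  change (S (c.symm (S q)))⁻¹ * S q = 1
  rw [hS, c.symm_apply_apply, inv_mul_cancel]

/-- The covariant function on `G` that restricts to `ψ` along the section `S`. -/
noncomputable def covariantExtension (hS : ∀ q, (S q : G ⧸ K) = c q)
    (τ : K →* unitary (V →L[ℂ] V)) (ψ : M → V) (g : G) : V :=
  ((τ (cosetPart hS g))⁻¹ : unitary (V →L[ℂ] V)).1 (ψ (c.symm g))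

theorem isCovariant_covariantExtension (hS : ∀ q, (S q : G ⧸ K) = c q) (ψ : M → V) :
    IsCovariant τ (covariantExtension hS τ ψ) := by
  intro g k
  rw [covariantExtension, covariantExtension, QuotientGroup.mk_mul_of_mem g k.2, cosetPart_mul,
    map_mul, mul_inv_rev, Submonoid.coe_mul, mul_apply_eq_comp]

theorem covariantExtension_section (hS : ∀ q, (S q : G ⧸ K) = c q) (ψ : M → V) (q : M) :
    covariantExtension hS τ ψ (S q) = ψ q := by
  rw [covariantExtension, cosetPart_section, hS, c.symm_apply_apply, map_one, inv_one,
    OneMemClass.coe_one, one_apply_eq_self]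

theorem IsCovariant.apply_section {f : G → V} (hf : IsCovariant τ f)
    (hS : ∀ q, (S q : G ⧸ K) = c q) (g : G) :
    f (S (c.symm g)) = (τ (cosetPart hS g)).1 (f g) := by
  conv_rhs => rw [← section_mul_cosetPart hS g, hf]
  rw [← mul_apply_eq_comp, ← Submonoid.coe_mul, section_mul_cosetPart, mul_inv_cancel,
    OneMemClass.coe_one, one_apply_eq_self]

variable [MeasurableSpace G] [MeasurableSpace M] [MeasurableSpace V] [BorelSpace V]

theorem IsCovariant.lintegral_enorm_sq_map {f : G → V} (hf : IsCovariant τ f)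
    (hf_meas : Measurable f) (hc : Measurable c) (hS : ∀ q, (S q : G ⧸ K) = c q) (μ : Measure M) :
    ∫⁻ q : G ⧸ K, ‖f q.out‖ₑ ^ 2 ∂μ.map c = ∫⁻ q, ‖f (S q)‖ₑ ^ 2 ∂μ := by
  rw [lintegral_map ((hf.measurable_enorm hf_meas).pow_const 2) hc]
  simp only [← ofReal_norm, ← hS, hf.norm_out]

variable [FiniteDimensional ℂ V]

theorem IsCovariant.integral_inner_map {f f' : G → V} (hf : IsCovariant τ f)
    (hf_meas : Measurable f) (hf' : IsCovariant τ f') (hf'_meas : Measurable f')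
    (hc : Measurable c) (hS : ∀ q, (S q : G ⧸ K) = c q) (μ : Measure M) :
    ∫ q : G ⧸ K, inner ℂ (f q.out) (f' q.out) ∂μ.map c = ∫ q, inner ℂ (f (S q)) (f' (S q)) ∂μ := by
  rw [integral_map hc.aemeasurable
    (hf.measurable_inner hf' hf_meas hf'_meas).aestronglyMeasurable]
  simp only [← hS, hf.inner_out hf']

section Measurability

variable [TopologicalSpace G] [IsTopologicalGroup G] [BorelSpace G] [TopologicalSpace M]

theorem measurable_covariantExtension (hS : ∀ q, (S q : G ⧸ K) = c q) (hS_cont : Continuous S)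
    (hr_cont : Continuous fun g : G => c.symm g) (hr_meas : Measurable fun g : G => c.symm g)
    (hτ : Continuous fun k => (τ k : V →L[ℂ] V)) {ψ : M → V} (hψ : Measurable ψ) :
    Measurable (covariantExtension hS τ ψ) := by
  have : ProperSpace V := FiniteDimensional.proper ℂ V
  have : SecondCountableTopology V := secondCountable_of_proper
  have hpart : Continuous (cosetPart hS) :=
    ((hS_cont.comp hr_cont).inv.mul continuous_id).subtype_mk _
  have hinv : Continuous fun g => ((τ (cosetPart hS g))⁻¹ : unitary (V →L[ℂ] V)).1 :=
    continuous_subtype_val.comp ((hτ.subtype_mk fun k => (τ k).2).comp hpart).inv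
  have happly : Continuous fun p : G × V =>
      ((τ (cosetPart hS p.1))⁻¹ : unitary (V →L[ℂ] V)).1 p.2 :=
    (hinv.comp continuous_fst).clm_apply continuous_snd
  have hpair : Measurable fun g : G => (g, ψ (c.symm g)) := measurable_id.prodMk (hψ.comp hr_meas)
  have hfactor : covariantExtension hS τ ψ =
      (fun p : G × V => ((τ (cosetPart hS p.1))⁻¹ : unitary (V →L[ℂ] V)).1 p.2)
        ∘ fun g : G => (g, ψ (c.symm g)) := by
    funext g
    rw [Function.comp_apply, covariantExtension]
  rw [hfactor]
  exact happly.measurable.comp hpair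

end Measurability

namespace HermitianGBundle.HasConstantMetric

variable [TopologicalSpace M] [OpensMeasurableSpace M] {l : G →* Equiv.Perm M}
  {B : HermitianGBundle l V} (hB : B.HasConstantMetric) (hS : ∀ q, (S q : G ⧸ K) = c q)
  (hc : Measurable c) (hS_meas : Measurable S) (τ) (μ : Measure M)

/-- Restriction of covariant functions along the section `S`, as a linear isometry from the space
of the induced representation to the square-integrable sections of a bundle with constant metric. -/
noncomputable def restrictSection : IndPre τ (μ.map c) →ₗᵢ[ℂ] B.L2Pre μ :=
  LinearMap.isometryOfInner
    { toFun := fun f => L2Pre.mk (fun q => f (S q)) (f.measurable.comp hS_meas) <| by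
        simpa only [hB.ofReal_metric_self,
          f.covariant.lintegral_enorm_sq_map f.measurable hc hS] using f.lintegral_lt_top
      map_add' := fun _ _ => L2Pre.ext fun _ => rfl
      map_smul' := fun _ _ => L2Pre.ext fun _ => rfl }
    fun f f' => by
      change ∫ q, B.metric q (f (S q)) (f' (S q)) ∂μ
        = ∫ q : G ⧸ K, inner ℂ (f q.out) (f' q.out) ∂μ.map c
      simp only [f.covariant.integral_inner_map f.measurable f'.covariant f'.measurable hc hS,
        hB _ _ _]

theorem restrictSection_surjective [TopologicalSpace G] [IsTopologicalGroup G] [BorelSpace G]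
    (hS_cont : Continuous S) (hr_cont : Continuous fun g : G => c.symm g)
    (hr_meas : Measurable fun g : G => c.symm g)
    (hτ : Continuous fun k => (τ k : V →L[ℂ] V)) :
    Function.Surjective (hB.restrictSection τ hS hc hS_meas μ) := by
  intro ψ
  have hcov := isCovariant_covariantExtension (τ := τ) hS ψ
  have hmeas := measurable_covariantExtension hS hS_cont hr_cont hr_meas hτ ψ.measurable
  refine ⟨IndPre.mk _ hmeas hcov ?_, L2Pre.ext (covariantExtension_section hS ψ)⟩
  simpa only [hcov.lintegral_enorm_sq_map hmeas hc hS, covariantExtension_section,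
    hB.ofReal_metric_self] using ψ.lintegral_lt_top

variable {μ} [MeasurableMul G]

theorem restrictSection_indPreRep (hμ : ∀ g, MeasurePreserving (l g) μ μ)
    (hμ' : ∀ g : G, MeasurePreserving (fun q : G ⧸ K => g • q) (μ.map c) (μ.map c))
    (hl : ∀ g q, c (l g q) = g • c q)
    (hact : ∀ g q v, (B.act g (q, v)).2 = (τ (cosetPart hS (g * S q))).1 v)
    (g : G) (f : IndPre τ (μ.map c)) :
    hB.restrictSection τ hS hc hS_meas μ (indPreRep τ hμ' g f)
      = B.preRep hμ g (hB.restrictSection τ hS hc hS_meas μ f) := by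
  refine L2Pre.ext fun q => ?_
  obtain ⟨q, rfl⟩ := (l g).surjective q
  have hq : c.symm (g * S q : G) = l g q := by
    rw [Equiv.symm_apply_eq, hl, ← hS]
    rfl
  have happly := (indPreRep τ hμ' g f).covariant.apply_section hS (g * S q)
  have htranslate : indPreRep τ hμ' g f (g * S q) = f (S q) :=
    congrArg f (inv_mul_cancel_left g (S q))
  rw [hq, htranslate, ← hact] at happly
  have hinv : (l g)⁻¹ (l g q) = q := (l g).symm_apply_apply q
  change indPreRep τ hμ' g f (S (l g q)) = (B.act g ((l g)⁻¹ (l g q), f (S ((l g)⁻¹ (l g q))))).2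
  rw [hinv, happly]

include hB hc hS_meas in
theorem unitarilyEquivalent_indRep [TopologicalSpace G] [IsTopologicalGroup G] [BorelSpace G]
    (hS_cont : Continuous S) (hr_cont : Continuous fun g : G => c.symm g)
    (hr_meas : Measurable fun g : G => c.symm g)
    (hτ : Continuous fun k => (τ k : V →L[ℂ] V)) (hμ : ∀ g, MeasurePreserving (l g) μ μ)
    (hμ' : ∀ g : G, MeasurePreserving (fun q : G ⧸ K => g • q) (μ.map c) (μ.map c))
    (hl : ∀ g q, c (l g q) = g • c q)
    (hact : ∀ g q v, (B.act g (q, v)).2 = (τ (cosetPart hS (g * S q))).1 v) :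
    UnitarilyEquivalent (indRep τ hμ') (B.rep hμ) :=
  ⟨separationMapEquiv _
      (hB.restrictSection_surjective τ hS hc hS_meas μ hS_cont hr_cont hr_meas hτ),
    separationMapEquiv_quotRep _ _ _ _
      (hB.restrictSection_indPreRep τ hS hc hS_meas hμ hμ' hl hact)⟩

end HermitianGBundle.HasConstantMetric

end InducedRepresentation

section LittleGroup

variable {G : Type*} [Group G] {N H : Subgroup G} [N.Normal] {ν : N →* Circle}
  {V : Type*} [NormedAddCommGroup V] [InnerProductSpace ℂ V] [CompleteSpace V]
  {σ : littleGroup H ν →* unitary (V →L[ℂ] V)} {L : H ⧸ littleGroup H ν → H}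

/-- The bijection `H / H_ν ≃ G / G_ν` given by `cosetMap`; its inverse is `n h G_ν ↦ h H_ν`. -/
noncomputable def cosetEquiv (hNH : Function.Bijective (mulMap N H)) (ν : N →* Circle) :
    H ⧸ littleGroup H ν ≃ G ⧸ isotropy ν where
  toFun := cosetMap H ν
  invFun := Quotient.map' (hPart hNH) fun a b hab => by
    rw [QuotientGroup.leftRel_apply] at hab ⊢
    have hmul : hPart hNH b = hPart hNH a * hPart hNH (a⁻¹ * b) := by
      rw [← (parts_mul hNH _ _).2, mul_inv_cancel_left]
    rw [hmul, inv_mul_cancel_left]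
    exact hPart_mem_littleGroup hNH hab
  left_inv := Quotient.ind' fun h =>
    congrArg QuotientGroup.mk (parts_eq hNH (n := 1) (one_mul (h : G))).2
  right_inv := Quotient.ind' fun g => by
    refine (QuotientGroup.eq (s := isotropy ν)).2 ?_
    have hconj : (hPart hNH g : G)⁻¹ * g
        = (MulAut.conjNormal (hPart hNH g : G)⁻¹ (nPart hNH g) : N) := by
      rw [MulAut.conjNormal_apply, inv_inv, mul_assoc, nPart_mul_hPart]
    rw [hconj]
    exact coe_mem_isotropy ν _

theorem coe_section_eq_cosetEquiv (hNH : Function.Bijective (mulMap N H))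
    (hL : ∀ q, (L q : H ⧸ littleGroup H ν) = q) (q : H ⧸ littleGroup H ν) :
    ((L q : G) : G ⧸ isotropy ν) = cosetEquiv hNH ν q :=
  congrArg (cosetMap H ν) (hL q)

theorem nuSigma_mk (hNH : Function.Bijective (mulMap N H)) (n : N) (h : littleGroup H ν)
    (hmem : (n : G) * (h : H) ∈ isotropy ν) (v : V) :
    (nuSigma hNH ν σ ⟨n * (h : H), hmem⟩).1 v = (ν n : ℂ) • (σ h : V →L[ℂ] V) v := by
  obtain ⟨hn, hh⟩ := parts_eq hNH (g := (n : G) * (h : H)) rfl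
  have hh' : (⟨_, hPart_mem_littleGroup hNH hmem⟩ : littleGroup H ν) = h := Subtype.ext hh
  change ((circleUnitary V (ν (nPart hNH ((n : G) * (h : H))))).1 *
    (σ ⟨hPart hNH ((n : G) * (h : H)), _⟩).1) v = _
  rw [hn, hh', mul_apply_eq_comp, circleUnitary_apply]

theorem nuSigma_cosetPart (hNH : Function.Bijective (mulMap N H))
    (hL : ∀ q, (L q : H ⧸ littleGroup H ν) = q) (g : G) (q : H ⧸ littleGroup H ν) (v : V) :
    (nuSigma hNH ν σ (cosetPart (coe_section_eq_cosetEquiv hNH hL) (g * L q))).1 v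
      = (charTwist ν (nPart hNH g) (hPart hNH g • q) : ℂ) •
        (σ (wigner hL (hPart hNH g) q) : V →L[ℂ] V) v := by
  set n := nPart hNH g
  set h := hPart hNH g
  have hcoset : (cosetEquiv hNH ν).symm (g * L q : G) = h • q := by
    rw [Equiv.symm_apply_eq]
    exact ((cosetMap_baseAction hNH g q).trans <|
      congrArg (g • ·) (coe_section_eq_cosetEquiv hNH hL q).symm).symm
  set m : N := MulAut.conjNormal (L (h • q) : G)⁻¹ n
  have hfactor : (L (h • q) : G)⁻¹ * (g * L q) = m * (wigner hL h q : H) := by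
    have hwigner : ((wigner hL h q : H) : G) = (L (h • q) : G)⁻¹ * h * L q := rfl
    have hg : g = n * h := (nPart_mul_hPart hNH g).symm
    rw [hwigner, MulAut.conjNormal_apply, hg]
    group
  have hmem : (m : G) * (wigner hL h q : H) ∈ isotropy ν :=
    mul_mem (coe_mem_isotropy ν m) (wigner hL h q).2
  have hpart : cosetPart (coe_section_eq_cosetEquiv hNH hL) (g * L q)
      = ⟨m * (wigner hL h q : H), hmem⟩ := by
    refine Subtype.ext (Eq.trans ?_ hfactor)
    change (L ((cosetEquiv hNH ν).symm (g * L q : G)) : G)⁻¹ * (g * L q) = _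
    rw [hcoset]
  rw [hpart, nuSigma_mk, ← charTwist_mk, hL]

variable [TopologicalSpace G]

theorem continuous_nuSigma (hNH : Function.Bijective (mulMap N H))
    (hn : Continuous (nPart hNH)) (hh : Continuous (hPart hNH)) (hν : Continuous ν)
    (hσ : Continuous fun k => (σ k : V →L[ℂ] V)) :
    Continuous fun k => (nuSigma hNH ν σ k : V →L[ℂ] V) := by
  have hchar : Continuous fun k : isotropy ν => (ν (nPart hNH (k : G)) : ℂ) :=
    continuous_subtype_val.comp (hν.comp (hn.comp continuous_subtype_val))
  have hrep : Continuous fun k : isotropy ν =>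
      (σ ⟨hPart hNH (k : G), hPart_mem_littleGroup hNH k.2⟩ : V →L[ℂ] V) :=
    hσ.comp ((hh.comp continuous_subtype_val).subtype_mk _)
  refine (hchar.smul hrep).congr fun k => ?_
  change _ = ((ν _ : ℂ) • (1 : V →L[ℂ] V)) * (σ _ : V →L[ℂ] V)
  rw [smul_mul_assoc, one_mul]
  rfl

theorem unitarilyEquivalent_indRep_boostingBundle [IsTopologicalGroup G] [MeasurableSpace G]
    [BorelSpace G] [MeasurableMul G] [FiniteDimensional ℂ V] [MeasurableSpace V] [BorelSpace V]
    (hNH : Function.Bijective (mulMap N H)) (hn : Continuous (nPart hNH))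
    (hh : Continuous (hPart hNH)) (hν : Continuous ν) (hσ : Continuous fun k => (σ k : V →L[ℂ] V))
    (hLc : Continuous L) (hL : ∀ q, (L q : H ⧸ littleGroup H ν) = q)
    (μ : Measure (H ⧸ littleGroup H ν)) [SMulInvariantMeasure H (H ⧸ littleGroup H ν) μ] :
    UnitarilyEquivalent (indRep (nuSigma hNH ν σ) (measurePreserving_cosetMap hNH μ))
      ((boostingBundle hNH hν hσ hLc hL).rep (measurePreserving_baseAction hNH μ)) := by
  have hS_cont : Continuous fun q => (L q : G) := continuous_subtype_val.comp hLc
  exact (hasConstantMetric_boostingBundle hNH hν hσ hLc hL).unitarilyEquivalent_indRep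
    (nuSigma hNH ν σ) (coe_section_eq_cosetEquiv hNH hL) measurable_cosetMap hS_cont.measurable
    hS_cont (QuotientGroup.continuous_mk.comp hh) (QuotientGroup.measurable_coe.comp hh.measurable)
    (continuous_nuSigma hNH hn hh hν hσ) (measurePreserving_baseAction hNH μ)
    (measurePreserving_cosetMap hNH μ) (cosetMap_baseAction hNH)
    fun g q v => (nuSigma_cosetPart hNH hL g q v).symm

end LittleGroup

/-! ### Strong continuity and the main theorem -/

theorem firstCountableTopology_of_chartedSpace (X M : Type*) [TopologicalSpace X]
    [FirstCountableTopology X] [TopologicalSpace M] [ChartedSpace X M] :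
    FirstCountableTopology M where
  nhds_generated_countable x := by
    rw [← (chartAt X x).symm_map_nhds_eq (mem_chart_source X x)]
    infer_instance

theorem borelSpace_quotient_of_section {K : Type*} [Group K] [TopologicalSpace K]
    [MeasurableSpace K] [BorelSpace K] {Γ : Subgroup K} {S : K ⧸ Γ → K} (hS_cont : Continuous S)
    (hS : ∀ q, (S q : K ⧸ Γ) = q) : BorelSpace (K ⧸ Γ) := by
  refine ⟨le_antisymm (fun s hs => ?_) OpensMeasurableSpace.borel_le⟩
  have hpreimage : MeasurableSet[borel K] ((QuotientGroup.mk : K → K ⧸ Γ) ⁻¹' s) :=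
    BorelSpace.measurable_eq (α := K) ▸ QuotientGroup.measurable_coe hs
  have hsection := hS_cont.borel_measurable hpreimage
  rwa [← Set.preimage_comp, show QuotientGroup.mk ∘ S = id from funext hS,
    Set.preimage_id] at hsection

theorem stronglyContinuous_rep_boostingBundle {EG EM : Type*} [NormedAddCommGroup EG]
    [NormedSpace ℝ EG] [NormedAddCommGroup EM] [NormedSpace ℝ EM] [FiniteDimensional ℝ EM]
    {G : Type*} [Group G] [TopologicalSpace G] [IsTopologicalGroup G] [ChartedSpace EG G]
    [MeasurableSpace G] [BorelSpace G] [MeasurableMul G] {N H : Subgroup G} [N.Normal]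
    {ν : N →* Circle} [ChartedSpace EM (H ⧸ littleGroup H ν)] {V : Type*} [NormedAddCommGroup V]
    [InnerProductSpace ℂ V] [FiniteDimensional ℂ V] [CompleteSpace V] [MeasurableSpace V]
    [BorelSpace V] {σ : littleGroup H ν →* unitary (V →L[ℂ] V)} {L : H ⧸ littleGroup H ν → H}
    {hNH : Function.Bijective (mulMap N H)} {hν : Continuous ν}
    {hσ : Continuous fun k => (σ k : V →L[ℂ] V)} {hLc : Continuous L}
    {hL : ∀ q, (L q : H ⧸ littleGroup H ν) = q}
    (hsmooth : (boostingBundle hNH hν hσ hLc hL).IsSmooth (EG := EG) (EM := EM))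
    (μ : Measure (H ⧸ littleGroup H ν)) [SMulInvariantMeasure H (H ⧸ littleGroup H ν) μ]
    [μ.Regular] :
    StronglyContinuous
      ((boostingBundle hNH hν hσ hLc hL).rep (measurePreserving_baseAction hNH μ)) := by
  have : FirstCountableTopology G := firstCountableTopology_of_chartedSpace EG G
  have : BorelSpace (H ⧸ littleGroup H ν) := borelSpace_quotient_of_section hLc hL
  have : LocallyCompactSpace (H ⧸ littleGroup H ν) := ChartedSpace.locallyCompactSpace EM _
  have hL_embedding : Topology.IsEmbedding L :=
    .of_leftInverse (f := QuotientGroup.mk) hL QuotientGroup.continuous_mk hLc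
  have : R1Space (H ⧸ littleGroup H ν) := hL_embedding.isInducing.r1Space
  exact (hasConstantMetric_boostingBundle hNH hν hσ hLc hL).stronglyContinuous_rep _
    hsmooth.base.continuous hsmooth.act.continuous

theorem theorem5p5_general
    {EG EN EH EM : Type*}
    [NormedAddCommGroup EG] [NormedSpace ℝ EG] [NormedAddCommGroup EN] [NormedSpace ℝ EN]
    [NormedAddCommGroup EH] [NormedSpace ℝ EH]
    [NormedAddCommGroup EM] [NormedSpace ℝ EM] [FiniteDimensional ℝ EM]
    {G : Type*} [Group G] [TopologicalSpace G] [IsTopologicalGroup G]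
    [ChartedSpace EG G] [LieGroup 𝓘(ℝ, EG) ∞ G] [MeasurableSpace G] [BorelSpace G]
    [MeasurableMul G] (N H : Subgroup G) [N.Normal]
    [ChartedSpace EN N] [ChartedSpace EH H] [LieGroup 𝓘(ℝ, EH) ∞ H]
    (hG : IsSmoothSemidirect (EG := EG) (EN := EN) (EH := EH) N H)
    (ν : N →* Circle) (hν : ContMDiff 𝓘(ℝ, EN) (𝓡 1) ∞ ν)
    {V : Type*} [NormedAddCommGroup V] [InnerProductSpace ℂ V] [CompleteSpace V]
    [FiniteDimensional ℂ V] [MeasurableSpace V] [BorelSpace V]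
    (σ : littleGroup H ν →* unitary (V →L[ℂ] V)) (hσ : Continuous fun k => (σ k : V →L[ℂ] V))
    (Φ : H →* (V →L[ℂ] V)ˣ)
    (hΦ : ContMDiff 𝓘(ℝ, EH) 𝓘(ℝ, V →L[ℂ] V) ∞ fun x => (Φ x : V →L[ℂ] V))
    (hΦσ : ∀ k : littleGroup H ν, (Φ k : V →L[ℂ] V) = σ k)
    [ChartedSpace EM (H ⧸ littleGroup H ν)]
    (hπ : ContMDiff 𝓘(ℝ, EH) 𝓘(ℝ, EM) ∞ (QuotientGroup.mk : H → H ⧸ littleGroup H ν))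
    (L : H ⧸ littleGroup H ν → H) (hLs : ContMDiff 𝓘(ℝ, EM) 𝓘(ℝ, EH) ∞ L)
    (hL : ∀ q, (L q : H ⧸ littleGroup H ν) = q)
    (μ : Measure (H ⧸ littleGroup H ν)) [SMulInvariantMeasure H (H ⧸ littleGroup H ν) μ] :
    let E := perceptionBundle hG.bijective hν.continuous hΦ.continuous hΦσ
    let EL := boostingBundle hG.bijective hν.continuous hσ hLs.continuous hL
    let Ind := indRep (nuSigma hG.bijective ν σ) (measurePreserving_cosetMap hG.bijective μ)
    let U := E.rep (measurePreserving_baseAction hG.bijective μ)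
    let UL := EL.rep (measurePreserving_baseAction hG.bijective μ)
    E.IsSmooth (EG := EG) (EM := EM) ∧ EL.IsSmooth (EG := EG) (EM := EM) ∧
    E.IsIso EL (boostMap Φ L) (EM := EM) ∧
    UnitarilyEquivalent Ind U ∧ UnitarilyEquivalent U UL ∧
    (∃ T : E.L2Section μ ≃ₗᵢ[ℂ] EL.L2Section μ,
      (∀ φ : E.L2Pre μ, ∃ ψ : EL.L2Pre μ,
        (∀ x, (x, ψ x) = boostMap Φ L (x, φ x)) ∧ T (E.toL2 μ φ) = EL.toL2 μ ψ) ∧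
      ∀ s f, T (U s f) = UL s (T f)) ∧
    (∃ S : (Lp ℂ 2 μ ⊗[ℂ] V) ≃ₗᵢ[ℂ] EL.L2Section μ,
      ∀ (f : Lp ℂ 2 μ) (v : V), ∃ ψ : EL.L2Pre μ,
        (∀ᵐ x ∂μ, ψ x = f x • v) ∧ S (f ⊗ₜ[ℂ] v) = EL.toL2 μ ψ) ∧
    (CompleteSpace (IndSpace (nuSigma hG.bijective ν σ) (μ.map (cosetMap H ν))) ∧
      CompleteSpace (E.L2Section μ) ∧ CompleteSpace (EL.L2Section μ)) ∧
    (μ.Regular → StronglyContinuous Ind ∧ StronglyContinuous U ∧ StronglyContinuous UL) := by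
  intro E EL Ind U UL
  have hE : E.IsSmooth (EG := EG) (EM := EM) := isSmooth_perceptionBundle hG hν hΦ hΦσ hπ hLs hL
  have hiso : E.IsIso EL (boostMap Φ L) (EM := EM) :=
    isIso_boostMap hG.bijective hν.continuous hσ hΦ hΦσ hLs hL
  have hEL : EL.IsSmooth (EG := EG) (EM := EM) := hiso.isSmooth hE
  have hmetric : EL.HasConstantMetric :=
    hasConstantMetric_boostingBundle hG.bijective hν.continuous hσ hLs.continuous hL
  have hIndUL : UnitarilyEquivalent Ind UL :=
    unitarilyEquivalent_indRep_boostingBundle hG.bijective hG.contMDiff_nPart.continuous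
      hG.contMDiff_hPart.continuous hν.continuous hσ hLs.continuous hL μ
  obtain ⟨T, hT, hTU⟩ := hiso.exists_unitaryEquiv (measurePreserving_baseAction hG.bijective μ)
  have hUUL : UnitarilyEquivalent U UL := ⟨T, hTU⟩
  have hcomplete : CompleteSpace (EL.L2Section μ) := hmetric.completeSpace_l2Section μ
  refine ⟨hE, hEL, hiso, hIndUL.trans hUUL.symm, hUUL, ⟨T, hT, hTU⟩, hmetric.exists_tensorEquiv μ,
    ⟨hIndUL.completeSpace, hUUL.completeSpace, hcomplete⟩, fun _ => ?_⟩
  have hUL : StronglyContinuous UL := stronglyContinuous_rep_boostingBundle hEL μ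
  exact ⟨hIndUL.stronglyContinuous hUL, hUUL.stronglyContinuous hUL, hUL⟩

theorem theorem5p5
    {EG EN EH EM : Type*}
    [NormedAddCommGroup EG] [NormedSpace ℝ EG] [FiniteDimensional ℝ EG]
    [NormedAddCommGroup EN] [NormedSpace ℝ EN] [FiniteDimensional ℝ EN]
    [NormedAddCommGroup EH] [NormedSpace ℝ EH] [FiniteDimensional ℝ EH]
    [NormedAddCommGroup EM] [NormedSpace ℝ EM] [FiniteDimensional ℝ EM]
    -- the Lie group `G = N ⋉ H`
    {G : Type*} [Group G] [TopologicalSpace G] [IsTopologicalGroup G] [T2Space G]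
    [SecondCountableTopology G] [ChartedSpace EG G] [LieGroup 𝓘(ℝ, EG) ∞ G]
    [MeasurableSpace G] [BorelSpace G]
    (N H : Subgroup G) [N.Normal]
    [ChartedSpace EN N] [LieGroup 𝓘(ℝ, EN) ∞ N] [ChartedSpace EH H] [LieGroup 𝓘(ℝ, EH) ∞ H]
    (hG : IsLieSemidirect (EG := EG) (EN := EN) (EH := EH) N H)
    -- the character `ν` of `N`
    (ν : N →* Circle) (hν : ContMDiff 𝓘(ℝ, EN) (𝓡 1) ∞ ν)
    -- the unitary representation `σ` of the little group and its extension `Φ` to `H`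
    {V : Type*} [NormedAddCommGroup V] [InnerProductSpace ℂ V] [CompleteSpace V]
    [FiniteDimensional ℂ V] [MeasurableSpace V] [BorelSpace V]
    (σ : littleGroup H ν →* unitary (V →L[ℂ] V)) (hσ : Continuous fun k => (σ k : V →L[ℂ] V))
    (Φ : H →* (V →L[ℂ] V)ˣ)
    (hΦ : ContMDiff 𝓘(ℝ, EH) 𝓘(ℝ, V →L[ℂ] V) ∞ fun x => (Φ x : V →L[ℂ] V))
    (hΦσ : ∀ k : littleGroup H ν, (Φ k : V →L[ℂ] V) = σ k)
    -- the smooth structure of the homogeneous space `H / H_ν`: the projection is a submersion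
    [ChartedSpace EM (H ⧸ littleGroup H ν)] [IsManifold 𝓘(ℝ, EM) ∞ (H ⧸ littleGroup H ν)]
    (hπ : Manifold.IsSubmersion 𝓘(ℝ, EH) 𝓘(ℝ, EM) ∞
      (QuotientGroup.mk : H → H ⧸ littleGroup H ν))
    -- the global section `L` and the invariant measure `μ`
    (L : H ⧸ littleGroup H ν → H) (hLs : ContMDiff 𝓘(ℝ, EM) 𝓘(ℝ, EH) ∞ L)
    (hL : ∀ q, (L q : H ⧸ littleGroup H ν) = q)
    (μ : Measure (H ⧸ littleGroup H ν)) [SMulInvariantMeasure H (H ⧸ littleGroup H ν) μ] :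
    let E := perceptionBundle hG.bijective hν.continuous hΦ.continuous hΦσ
    let EL := boostingBundle hG.bijective hν.continuous hσ hLs.continuous hL
    let Ind := indRep (nuSigma hG.bijective ν σ) (measurePreserving_cosetMap hG.bijective μ)
    let U := E.rep (measurePreserving_baseAction hG.bijective μ)
    let UL := EL.rep (measurePreserving_baseAction hG.bijective μ)
    -- both are (smooth) Hermitian `G`-bundles, and `α` is an isomorphism between them
    E.IsSmooth (EG := EG) (EM := EM) ∧ EL.IsSmooth (EG := EG) (EM := EM) ∧
    E.IsIso EL (boostMap Φ L) (EM := EM) ∧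
    -- `Ind ≅ U ≅ U_L`
    UnitarilyEquivalent Ind U ∧ UnitarilyEquivalent U UL ∧
    -- composition with `α` is a unitary equivalence of `U` and `U_L`
    (∃ T : E.L2Section μ ≃ₗᵢ[ℂ] EL.L2Section μ,
      (∀ φ : E.L2Pre μ, ∃ ψ : EL.L2Pre μ,
        (∀ x, (x, ψ x) = boostMap Φ L (x, φ x)) ∧ T (E.toL2 μ φ) = EL.toL2 μ ψ) ∧
      ∀ s f, T (U s f) = UL s (T f)) ∧
    -- the `L²`-section space of the boosting bundle is `L²(H/H_ν; μ) ⊗ V`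
    (∃ S : (Lp ℂ 2 μ ⊗[ℂ] V) ≃ₗᵢ[ℂ] EL.L2Section μ,
      ∀ (f : Lp ℂ 2 μ) (v : V), ∃ ψ : EL.L2Pre μ,
        (∀ᵐ x ∂μ, ψ x = f x • v) ∧ S (f ⊗ₜ[ℂ] v) = EL.toL2 μ ψ) ∧
    -- the representation spaces are Hilbert spaces, and the representations are strongly
    -- continuous if `μ` is a Radon measure
    (CompleteSpace (IndSpace (nuSigma hG.bijective ν σ) (μ.map (cosetMap H ν))) ∧
      CompleteSpace (E.L2Section μ) ∧ CompleteSpace (EL.L2Section μ)) ∧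
    (μ.Regular → StronglyContinuous Ind ∧ StronglyContinuous U ∧ StronglyContinuous UL) :=
  theorem5p5_general N H hG.diffeo ν hν σ hσ Φ hΦ hΦσ hπ.contMDiff L hLs hL μ
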